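/- **Setting.** Let $K,N,T\ge 1$. Agent $k\in\{1,\dots,K\}$ has a loss $Q_k(z;\xi)$, $z=\mathrm{col}\{x,y\}\in\mathbb R^{M_1+M_2}$, twice differentiable in $z$, and a data distribution $\mathcal D_k$; $J_k(z)=\mathbb E_{\xi\sim\mathcal D_k}Q_k(z;\xi)$, $J=\frac1K\sum_kJ_k$. All vector norms are Euclidean and norms of Hessians are spectral. Let $L_f,\nu>0$ and $L_h,\sigma,\sigma_h\ge0$, and assume: (1) each $J_k$ is $C^2$ with $L_f$-Lipschitz gradient and $L_h$-Lipschitz Hessian; (2) for all $k,z$, $\nabla Q_k(z;\xi)$ and $\nabla^2Q_k(z;\xi)$, $\xi\sim\mathcal D_k$, have means $\nabla J_k(z)$ and $\nabla^2J_k(z)$, with $\mathbb E\|\nabla Q_k-\nabla J_k\|^2\le\sigma^2$ and $\mathbb E\|\nabla^2Q_k-\nabla^2J_k\|^2\le\sigma_h^2$; (3) $P(x)=\max_yJ(x,y)$ is attained for every $x$, $\|\nabla_yJ(x,y)\|^2\ge2\nu\,(P(x)-J(x,y))$ for all $(x,y)$, and $P^\star=\inf_xP>-\infty$. No bound on the dissimilarity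 of the $\nabla J_k$ is assumed. Put $\kappa=L_f/\nu$, $L=L_f+\tfrac12L_f\kappa$. **Fed-MiMA** (with $v/\|v\|:=0$ if $v=0$). Parameters: $\mu_x,\mu_y,\bar\mu_x,\bar\mu_y,\beta$. Start from (possibly random) $z_0=(x_0,y_0)$, $z_{-1}=(x_{-1},y_{-1})$ with $\|x_0-x_{-1}\|\le\mu_x$, $\|y_0-y_{-1}\|\le\mu_y$ almost surely, and $m_{-1}=\frac1K\sum_k\nabla Q_k(z_{-1};\xi_{k,-1})$. In round $i=0,\dots,T-1$ each agent sets $z_{k,i,0}=z_i$ and, for $n=0,\dots,N-1$, $g_{k,i,n}=\nabla Q_k(z_{k,i,n};\xi_{k,i,n})$, $x_{k,i,n+1}=x_{k,i,n}-\bar\mu_x\,g^x_{k,i,n}/\|g^x_{k,i,n}\|$, $y_{k,i,n+1}=y_{k,i,n}+\bar\mu_y\,g^y_{k,i,n}/\|g^y_{k,i,n}\|$; put $g_{k,i}=\frac1N\sum_ng_{k,i,n}$ and $h_{k,i}=\frac1N\sum_n\nabla^2Q_k(z_i;\xi_{k,i,n})(z_i-z_{i-1})$. The server sets $$m_i=(1-\beta)\Big(m_{i-1}+\tfrac1K\sum_kh_{k,i}\Big)+\tfrac\beta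 K\sum_kg_{k,i},\qquad x_{i+1}=x_i-\mu_x\frac{m^x_i}{\|m^x_i\|},\quad y_{i+1}=y_i+\mu_y\frac{m^y_i}{\|m^y_i\|}.$$ All samples are independent, with $\xi_{k,-1},\xi_{k,i,n}\sim\mathcal D_k$; the $\xi_{k,-1}$ are independent of $z_{-1}$, and the $\xi_{k,i,n}$, $i\ge0$, are independent of $(z_0,z_{-1},(\xi_{k,-1})_k)$. $P(x_0)$ and $\Delta_0=P(x_0)-J(x_0,y_0)$ are integrable. Let $\|y_0-y^o(x_0)\|$ be the distance from $y_0$ to $\arg\max_yJ(x_0,y)$, and $$\mathcal G_T=\frac1T\sum_{i=0}^{T-1}\mathbb E\big[\|\nabla_xJ(x_i,y_i)\|+\|\nabla_yJ(x_i,y_i)\|\big].$$ **Theorem.** (i) If $0<\mu_x\le\mu_y/(6\kappa)$, $\bar\mu_x,\bar\mu_y\ge0$ and $0<\beta\le1$, then the expectations in $\mathcal G_T$ are finite and $$\mathcal G_T\le\frac{3(\mathbb EP(x_0)-P^\star)}{\mu_xT}+\frac{20L_f\,\mathbb E\|y_0-y^o(x_0)\|}{T}+\frac{60\kappa\,\mathbb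 E\Delta_0}{\mu_yT}+C_1'\mu_x+C_2'\mu_y+C_3'\Big(\frac{\sigma}{T\sqrt K\beta}+\frac{L_h(\mu_x^2+\mu_y^2)}{2\beta}+\frac{NL_f(\bar\mu_x+\bar\mu_y)}2+\frac{\sigma_h(\mu_x+\mu_y)}{\sqrt{\beta KN}}+\frac{\sqrt\beta\,\sigma}{\sqrt{KN}}\Big),$$ with $C_1'=5L_f+170\kappa L_f+\frac32L$, $C_2'=30\kappa L_f+20L_f$, $C_3'=160\kappa+8$. (ii) Let $s=(NK)^{1/3}/T^{2/3}$, and suppose $\kappa\ge1$, $\bar\mu_x=\mu_x/(NL_f)$, $\bar\mu_y=\mu_y/(NL_f)$, $\mu_x\le\mu_y/(6\kappa)$ and that $\mathbb EP(x_0)-P^\star$, $\mathbb E\|y_0-y^o(x_0)\|$, $\mathbb E\Delta_0$ are at most $D$. If, for constants $0<a\le b$, $\beta,\mu_y\in[as,bs]$, $\mu_x\in[as/\kappa,bs/\kappa]$ and $\beta\le1$ (which holds for some such parameters once $T$ is large), then $$\mathcal G_T\le C\Big(\frac{\kappa}{(NKT)^{1/3}}+\frac{\kappa(NK)^{1/3}}{T^{2/3}}\Big),$$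 where $C$ depends only on $L_f,L_h,\sigma,\sigma_h,D,a,b$ (not on $\kappa,N,K,T$ or the dimensions). (iii) Under the assumptions of (ii) on $\kappa$, $\bar\mu_x$, $\bar\mu_y$, $D$ and $\mu_x\le\mu_y/(6\kappa)$, with $\sigma,\sigma_h,\mathbb E\Delta_0,\mathbb EP(x_0)-P^\star>0$, the same bound, with $C$ depending only on $L_f,L_h,\sigma,\sigma_h,D$, holds for all $T\ge\sqrt{NK}$ with the choice $\beta=\min\{\sigma s,\,s/\sigma^2,\,1\}$, $\mu_y=\min\{s\,\mathbb E\Delta_0,\,s/\sigma_h\}$, $\mu_x=\min\{s/(\sigma_h\kappa),\,s(\mathbb EP(x_0)-P^\star)/\kappa\}$. -/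

import Mathlib

open MeasureTheory ProbabilityTheory

noncomputable section

namespace FedMiMA

/-- The space of pairs `z = col{x, y}`, with the Euclidean norm of the concatenated vector. -/
abbrev Pt (M₁ M₂ : ℕ) : Type :=
  WithLp 2 (EuclideanSpace ℝ (Fin M₁) × EuclideanSpace ℝ (Fin M₂))

/-- The pair `col{x, y}`. -/
def pt {M₁ M₂ : ℕ} (x : EuclideanSpace ℝ (Fin M₁)) (y : EuclideanSpace ℝ (Fin M₂)) : Pt M₁ M₂ :=
  WithLp.toLp 2 (x, y)

/-- The gradient `∇_z f`; its two components are `∇_x f` and `∇_y f`. -/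
def grad {M₁ M₂ : ℕ} (f : Pt M₁ M₂ → ℝ) (z : Pt M₁ M₂) : Pt M₁ M₂ := gradient f z

/-- The Hessian `∇²_z f`, as a linear operator (so that its norm is the spectral norm). -/
def hess {M₁ M₂ : ℕ} (f : Pt M₁ M₂ → ℝ) (z : Pt M₁ M₂) : Pt M₁ M₂ →L[ℝ] Pt M₁ M₂ :=
  fderiv ℝ (grad f) z

/-- The Hessian-vector product `∇²f(z₁) (z₁ - z₂)`. -/
def hvp {M₁ M₂ : ℕ} (f : Pt M₁ M₂ → ℝ) (z₁ z₂ : Pt M₁ M₂) : Pt M₁ M₂ := hess f z₁ (z₁ - z₂)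

/-- A federated stochastic minimax problem: a loss `Q_k(z; ξ)` and a data distribution `𝒟_k`
for each of the `K` agents. -/
structure Problem (M₁ M₂ K : ℕ) (Ξ : Type*) [MeasurableSpace Ξ] where
  /-- `loss k ξ z` is `Q_k(x, y; ξ)` with `z = col{x, y}`. -/
  loss : Fin K → Ξ → Pt M₁ M₂ → ℝ
  /-- The data distribution of agent `k`. -/
  law : Fin K → Measure Ξ

namespace Problem

variable {M₁ M₂ K : ℕ} {Ξ : Type*} [MeasurableSpace Ξ]

/-- The local cost `J_k(z) = 𝔼_{ξ ∼ 𝒟_k} Q_k(z; ξ)`. -/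
def localCost (prob : Problem M₁ M₂ K Ξ) (k : Fin K) (z : Pt M₁ M₂) : ℝ :=
  ∫ ξ, prob.loss k ξ z ∂(prob.law k)

/-- The global cost `J = (1/K) ∑_k J_k`. -/
def cost (prob : Problem M₁ M₂ K Ξ) (z : Pt M₁ M₂) : ℝ :=
  (1 / (K : ℝ)) * ∑ k, prob.localCost k z

/-- The envelope `P(x) = max_y J(x, y)`. -/
def envelope (prob : Problem M₁ M₂ K Ξ) (x : EuclideanSpace ℝ (Fin M₁)) : ℝ :=
  ⨆ y, prob.cost (pt x y)

/-- `P^⋆ = inf_x P(x)`. -/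
def envelopeInf (prob : Problem M₁ M₂ K Ξ) : ℝ := ⨅ x, prob.envelope x

/-- The set of maximizers of `J(x, ·)`. -/
def argmax (prob : Problem M₁ M₂ K Ξ) (x : EuclideanSpace ℝ (Fin M₁)) :
    Set (EuclideanSpace ℝ (Fin M₂)) :=
  {y | ∀ y', prob.cost (pt x y') ≤ prob.cost (pt x y)}

/-- `‖y - y^o(x)‖`, where `y^o(x)` is the maximizer of `J(x, ·)` that is nearest to `y`. -/
def distArgmax (prob : Problem M₁ M₂ K Ξ) (z : Pt M₁ M₂) : ℝ :=
  Metric.infDist z.snd (prob.argmax z.fst)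

/-- The optimality gap `Δ = P(x) - J(x, y)`. -/
def gap (prob : Problem M₁ M₂ K Ξ) (z : Pt M₁ M₂) : ℝ := prob.envelope z.fst - prob.cost z

/-- Well-posedness of the stochastic problem: the `𝒟_k` are probability distributions, the losses
are integrable and twice differentiable, and their derivatives are jointly measurable. -/
structure WellPosed (prob : Problem M₁ M₂ K Ξ) : Prop where
  prob_law : ∀ k, IsProbabilityMeasure (prob.law k)
  integrable_loss : ∀ k z, Integrable (fun ξ => prob.loss k ξ z) (prob.law k)
  diff_loss : ∀ k ξ, Differentiable ℝ (prob.loss k ξ)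
  diff_grad : ∀ k ξ, Differentiable ℝ (grad (prob.loss k ξ))
  meas_grad : ∀ k, Measurable (fun q : Pt M₁ M₂ × Ξ => grad (prob.loss k q.2) q.1)
  meas_hess : ∀ k, Measurable (fun q : Pt M₁ M₂ × Ξ => hess (prob.loss k q.2) q.1)

/-- Lipschitz conditions: every `J_k` is twice continuously differentiable, with `Lf`-Lipschitz
gradient and `Lh`-Lipschitz Hessian. -/
structure LipschitzConditions (prob : Problem M₁ M₂ K Ξ) (Lf Lh : ℝ) : Prop where
  contDiff : ∀ k, ContDiff ℝ 2 (prob.localCost k)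
  smooth : ∀ k z₁ z₂,
    ‖grad (prob.localCost k) z₁ - grad (prob.localCost k) z₂‖ ≤ Lf * ‖z₁ - z₂‖
  hess_lipschitz : ∀ k z₁ z₂,
    ‖hess (prob.localCost k) z₁ - hess (prob.localCost k) z₂‖ ≤ Lh * ‖z₁ - z₂‖

/-- The stochastic gradients and Hessians are unbiased and have variance at most `σ²`, `σh²`. -/
structure BoundedVariance (prob : Problem M₁ M₂ K Ξ) (σ σh : ℝ) : Prop where
  integrable_grad : ∀ k z, Integrable (fun ξ => grad (prob.loss k ξ) z) (prob.law k)
  unbiased_grad : ∀ k z,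
    ∫ ξ, grad (prob.loss k ξ) z ∂(prob.law k) = grad (prob.localCost k) z
  integrable_hess : ∀ k z, Integrable (fun ξ => hess (prob.loss k ξ) z) (prob.law k)
  unbiased_hess : ∀ k z,
    ∫ ξ, hess (prob.loss k ξ) z ∂(prob.law k) = hess (prob.localCost k) z
  integrable_sq_grad : ∀ k z,
    Integrable (fun ξ => ‖grad (prob.loss k ξ) z - grad (prob.localCost k) z‖ ^ 2) (prob.law k)
  variance_grad : ∀ k z,
    ∫ ξ, ‖grad (prob.loss k ξ) z - grad (prob.localCost k) z‖ ^ 2 ∂(prob.law k) ≤ σ ^ 2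
  integrable_sq_hess : ∀ k z,
    Integrable (fun ξ => ‖hess (prob.loss k ξ) z - hess (prob.localCost k) z‖ ^ 2) (prob.law k)
  variance_hess : ∀ k z,
    ∫ ξ, ‖hess (prob.loss k ξ) z - hess (prob.localCost k) z‖ ^ 2 ∂(prob.law k) ≤ σh ^ 2

/-- `max_y J(x, y)` is attained, `-J(x, ·)` is `ν`-PL for every `x`, and `P` is bounded below. -/
structure CostConditions (prob : Problem M₁ M₂ K Ξ) (ν : ℝ) : Prop where
  max_attained : ∀ x, (prob.argmax x).Nonempty
  pl : ∀ z, 2 * ν * (prob.envelope z.fst - prob.cost z) ≤ ‖(grad prob.cost z).snd‖ ^ 2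
  bddBelow : BddBelow (Set.range prob.envelope)

/-- The standing assumptions on a problem with parameters `Lf, Lh, σ, σh, ν`. -/
structure Assumptions (prob : Problem M₁ M₂ K Ξ) (Lf Lh σ σh ν : ℝ) : Prop where
  Lf_pos : 0 < Lf
  Lh_nonneg : 0 ≤ Lh
  σ_nonneg : 0 ≤ σ
  σh_nonneg : 0 ≤ σh
  ν_pos : 0 < ν
  wellPosed : prob.WellPosed
  lipschitz : prob.LipschitzConditions Lf Lh
  variance : prob.BoundedVariance σ σh
  costCond : prob.CostConditions ν

end Problem

/-- Hyperparameters: server step sizes `μx, μy`, local step sizes `locμx, locμy`, momentum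
smoothing factor `β`, and the switch `γ ∈ {0, 1}` of the Hessian correction. -/
structure Params where
  μx : ℝ
  μy : ℝ
  locμx : ℝ
  locμy : ℝ
  β : ℝ
  γ : ℝ

/-- `v / ‖v‖`, with the convention that it is `0` for `v = 0`. -/
def unit {E : Type*} [NormedAddCommGroup E] [NormedSpace ℝ E] (v : E) : E := ‖v‖⁻¹ • v

/-- Normalized descent in `x` and ascent in `y` along `d` from `z`, with step sizes `a`, `b`. -/
def gdaStep {M₁ M₂ : ℕ} (a b : ℝ) (z d : Pt M₁ M₂) : Pt M₁ M₂ :=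
  pt (z.fst - a • unit d.fst) (z.snd + b • unit d.snd)

section Algorithm

variable {M₁ M₂ K : ℕ} {Ξ : Type*} [MeasurableSpace Ξ]

/-- The local iterates `(x_{k,i,n}, y_{k,i,n})`, `n = 0, 1, …`, of agent `k` in one round that
starts from the server iterate `z`, where `ξ n` is the sample of local step `n`. -/
def localIter (prob : Problem M₁ M₂ K Ξ) (p : Params) (k : Fin K) (z : Pt M₁ M₂) (ξ : ℕ → Ξ) :
    ℕ → Pt M₁ M₂
  | 0 => z
  | n + 1 =>
    gdaStep p.locμx p.locμy (localIter prob p k z ξ n)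
      (grad (prob.loss k (ξ n)) (localIter prob p k z ξ n))

/-- The accumulated local gradient `(g^x_{k,i}, g^y_{k,i})` over `N` local steps. -/
def localGrad (prob : Problem M₁ M₂ K Ξ) (p : Params) (N : ℕ) (k : Fin K) (z : Pt M₁ M₂)
    (ξ : ℕ → Ξ) : Pt M₁ M₂ :=
  ∑ n ∈ Finset.range N, (1 / (N : ℝ)) • grad (prob.loss k (ξ n)) (localIter prob p k z ξ n)

/-- The accumulated momentum correction `(h^x_{k,i}, h^y_{k,i})` over `N` local samples; `z` and
`zprev` are the current and the previous server iterate. -/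
def localHvp (prob : Problem M₁ M₂ K Ξ) (N : ℕ) (k : Fin K) (z zprev : Pt M₁ M₂)
    (ξ : ℕ → Ξ) : Pt M₁ M₂ :=
  ∑ n ∈ Finset.range N, (1 / (N : ℝ)) • hvp (prob.loss k (ξ n)) z zprev

/-- What the server holds at the beginning of round `i`: the iterate `(x_i, y_i)`, the previous
iterate `(x_{i-1}, y_{i-1})` and the momentum `(m^x_{i-1}, m^y_{i-1})`. -/
structure ServerState (M₁ M₂ : ℕ) where
  cur : Pt M₁ M₂
  prev : Pt M₁ M₂
  mom : Pt M₁ M₂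

/-- The server momentum `(m^x_i, m^y_i)` computed in a round with samples `ξ k n`. -/
def nextMom (prob : Problem M₁ M₂ K Ξ) (p : Params) (N : ℕ) (s : ServerState M₁ M₂)
    (ξ : Fin K → ℕ → Ξ) : Pt M₁ M₂ :=
  (1 - p.β) • (s.mom + (p.γ / (K : ℝ)) • ∑ k, localHvp prob N k s.cur s.prev (ξ k))
    + (p.β / (K : ℝ)) • ∑ k, localGrad prob p N k s.cur (ξ k)

/-- One communication round. -/
def serverStep (prob : Problem M₁ M₂ K Ξ) (p : Params) (N : ℕ) (s : ServerState M₁ M₂)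
    (ξ : Fin K → ℕ → Ξ) : ServerState M₁ M₂ where
  cur := gdaStep p.μx p.μy s.cur (nextMom prob p N s ξ)
  prev := s.cur
  mom := nextMom prob p N s ξ

/-- The initial momentum `m_{-1} = (1/K) ∑_k ∇_z Q_k(z_{-1}; ξ_{k,-1})`. -/
def initMom (prob : Problem M₁ M₂ K Ξ) (zm : Pt M₁ M₂) (ξinit : Fin K → Ξ) : Pt M₁ M₂ :=
  (1 / (K : ℝ)) • ∑ k, grad (prob.loss k (ξinit k)) zm

/-- The server states of Fed-MiMA started from `z_0 = z₀`, `z_{-1} = zm`, with samples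
`ξinit k = ξ_{k,-1}` and `ξ (k, i, n) = ξ_{k,i,n}`. -/
def serverState (prob : Problem M₁ M₂ K Ξ) (p : Params) (N : ℕ) (z₀ zm : Pt M₁ M₂)
    (ξinit : Fin K → Ξ) (ξ : Fin K × ℕ × ℕ → Ξ) : ℕ → ServerState M₁ M₂
  | 0 => ⟨z₀, zm, initMom prob zm ξinit⟩
  | i + 1 => serverStep prob p N (serverState prob p N z₀ zm ξinit ξ i) (fun k n => ξ (k, i, n))

end Algorithm

section Run

variable {M₁ M₂ K : ℕ} {Ξ Ω : Type*} [MeasurableSpace Ξ] [MeasurableSpace Ω]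

/-- The random data of a run: the initial points `z_0`, `z_{-1}` and the samples. -/
structure RunData (M₁ M₂ K : ℕ) (Ξ Ω : Type*) where
  z₀ : Ω → Pt M₁ M₂
  zm : Ω → Pt M₁ M₂
  /-- `ξinit k` is `ξ_{k,-1}`. -/
  ξinit : Fin K → Ω → Ξ
  /-- `ξ (k, i, n)` is `ξ_{k,i,n}`. -/
  ξ : Fin K × ℕ × ℕ → Ω → Ξ

/-- The sampling model: agent `k` draws from `𝒟_k`, all samples are independent, the samples drawn
for the initial momentum are independent of `z_{-1}`, and the samples of the rounds `0, 1, …` are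
independent of the initialization. The initial points obey the step-size bounds that the update
rule gives for all later pairs of consecutive iterates, and the initial function values are
integrable. -/
structure RunData.Valid (R : RunData M₁ M₂ K Ξ Ω) (prob : Problem M₁ M₂ K Ξ) (p : Params)
    (ρ : Measure Ω) : Prop where
  meas_z₀ : Measurable R.z₀
  meas_zm : Measurable R.zm
  meas_ξinit : ∀ k, Measurable (R.ξinit k)
  meas_ξ : ∀ s, Measurable (R.ξ s)
  law_ξinit : ∀ k, ρ.map (R.ξinit k) = prob.law k
  law_ξ : ∀ s, ρ.map (R.ξ s) = prob.law s.1
  indep_ξinit : iIndepFun R.ξinit ρ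
  indep_ξ : iIndepFun R.ξ ρ
  indep_zm : IndepFun R.zm (fun ω k => R.ξinit k ω) ρ
  indep_init : IndepFun (fun ω => (R.z₀ ω, R.zm ω, fun k => R.ξinit k ω)) (fun ω s => R.ξ s ω) ρ
  init_x : ∀ᵐ ω ∂ρ, ‖(R.z₀ ω).fst - (R.zm ω).fst‖ ≤ p.μx
  init_y : ∀ᵐ ω ∂ρ, ‖(R.z₀ ω).snd - (R.zm ω).snd‖ ≤ p.μy
  integrable_envelope : Integrable (fun ω => prob.envelope (R.z₀ ω).fst) ρ
  integrable_gap : Integrable (fun ω => prob.gap (R.z₀ ω)) ρ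

/-- The server iterate `(x_i, y_i)`. -/
def RunData.iter (R : RunData M₁ M₂ K Ξ Ω) (prob : Problem M₁ M₂ K Ξ) (p : Params) (N i : ℕ)
    (ω : Ω) : Pt M₁ M₂ :=
  (serverState prob p N (R.z₀ ω) (R.zm ω) (fun k => R.ξinit k ω) (fun s => R.ξ s ω) i).cur

/-- `‖∇_x J(x_i, y_i)‖ + ‖∇_y J(x_i, y_i)‖`. -/
def RunData.stat (R : RunData M₁ M₂ K Ξ Ω) (prob : Problem M₁ M₂ K Ξ) (p : Params) (N i : ℕ)
    (ω : Ω) : ℝ :=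
  ‖(grad prob.cost (R.iter prob p N i ω)).fst‖ + ‖(grad prob.cost (R.iter prob p N i ω)).snd‖

/-- `(1/T) ∑_{i<T} 𝔼[‖∇_x J(x_i, y_i)‖ + ‖∇_y J(x_i, y_i)‖]`. -/
def RunData.avgStat (R : RunData M₁ M₂ K Ξ Ω) (prob : Problem M₁ M₂ K Ξ) (p : Params)
    (ρ : Measure Ω) (N T : ℕ) : ℝ :=
  (1 / (T : ℝ)) * ∑ i ∈ Finset.range T, ∫ ω, R.stat prob p N i ω ∂ρ

/-- `𝔼 P(x_0) - P^⋆`. -/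
def RunData.envGap₀ (R : RunData M₁ M₂ K Ξ Ω) (prob : Problem M₁ M₂ K Ξ) (ρ : Measure Ω) : ℝ :=
  ∫ ω, prob.envelope (R.z₀ ω).fst ∂ρ - prob.envelopeInf

/-- `𝔼 Δ_0`. -/
def RunData.gap₀ (R : RunData M₁ M₂ K Ξ Ω) (prob : Problem M₁ M₂ K Ξ) (ρ : Measure Ω) : ℝ :=
  ∫ ω, prob.gap (R.z₀ ω) ∂ρ

/-- `𝔼 ‖y_0 - y^o(x_0)‖`. -/
def RunData.dist₀ (R : RunData M₁ M₂ K Ξ Ω) (prob : Problem M₁ M₂ K Ξ) (ρ : Measure Ω) : ℝ :=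
  ∫ ω, prob.distArgmax (R.z₀ ω) ∂ρ

end Run

/-- `C'_1 = 5 L_f + 170 κ L_f + 3L/2` with `L = L_f + L_f κ / 2`. -/
def C₁ (Lf κ : ℝ) : ℝ := 5 * Lf + 170 * κ * Lf + 3 * (Lf + Lf * κ / 2) / 2

/-- `C'_2 = 30 κ L_f + 20 L_f`. -/
def C₂ (Lf κ : ℝ) : ℝ := 30 * κ * Lf + 20 * Lf

/-- `C'_3 = 160 κ + 8`. -/
def C₃ (κ : ℝ) : ℝ := 160 * κ + 8

/-- The explicit bound; `E₀`, `d₀`, `Δ₀` stand for `𝔼 P(x_0) - P^⋆`, `𝔼 ‖y_0 - y^o(x_0)‖`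
and `𝔼 Δ_0`. -/
def explicitBound (Lf Lh σ σh κ : ℝ) (p : Params) (K N T : ℕ) (E₀ d₀ Δ₀ : ℝ) : ℝ :=
  3 * E₀ / (p.μx * T) + 20 * Lf * d₀ / T + 60 * κ * Δ₀ / (p.μy * T)
    + C₁ Lf κ * p.μx + C₂ Lf κ * p.μy
    + C₃ κ * (σ / (T * √(K : ℝ) * p.β) + Lh * (p.μx ^ 2 + p.μy ^ 2) / (2 * p.β)
        + N * Lf * (p.locμx + p.locμy) / 2
        + σh * (p.μx + p.μy) / √(p.β * K * N)
        + √p.β / √((K : ℝ) * N) * σ)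

/-- The scale `(NK)^{1/3} / T^{2/3}` of the hyperparameters. -/
def scale (K N T : ℕ) : ℝ := ((N : ℝ) * K) ^ (1 / 3 : ℝ) / (T : ℝ) ^ (2 / 3 : ℝ)

/-- The rate `κ / (NKT)^{1/3} + κ (NK)^{1/3} / T^{2/3}`. -/
def rate (κ : ℝ) (K N T : ℕ) : ℝ :=
  κ / ((N : ℝ) * K * T) ^ (1 / 3 : ℝ)
    + κ * ((N : ℝ) * K) ^ (1 / 3 : ℝ) / (T : ℝ) ^ (2 / 3 : ℝ)

end FedMiMA

end

universe u v

noncomputable section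

namespace FedMiMA

/-! ### Taylor bounds and normalized steps. -/

section Smooth

variable {M₁ M₂ : ℕ}

/-! The argument separates a pathwise descent estimate from a probabilistic bound on the momentum
error `m_i - ∇J(z_i)`.

Pathwise, a normalized step along `m` gains `‖g‖ - 2‖m - g‖` per unit length against the true
gradient `g`. The envelope `P` is never differentiated. Instead, the PL condition yields a maximizer
of `J(x', ·)` within `(2/ν)‖∇_y J‖` of the current `y` (`exists_argmax_near`), and comparing `J(x',
·)` with `J(x, ·)` at this maximizer bounds `P(x') - P(x)` (`envelope_sub_le`). The price is a term
`2κ μx ‖∇_y J‖`, which the decrease of the gap `P - J` absorbs because `μx ≤ μy/(6κ)`. Telescoping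
both decreases gives `sum_stat_le`, where only the summed momentum errors remain.

For the momentum, the Hessian correction moves the target of `m_{i-1}` from `∇J(z_{i-1})` to
`∇J(z_i)` up to second order. The error thus contracts by `1 - β` and receives a linearization
error, a local drift, and centred Hessian and gradient noise (`nextMom_sub_grad`). Normalized local
steps have bounded length whatever the local gradients are, so the drift bound involves no
dissimilarity between agents. After unrolling, the noise terms of each kind are pairwise orthogonal
in `L²`, since of two samples at least one does not influence the point at which the other is used
(`integral_norm_sum_noise_le`). Their variances add up, which gives the factor `1/√(KN)`.

The rates follow by inserting steps of order `s`, using `1/(sT) = r` and `s = KN r²` with `r =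
(NKT)^{-1/3}`. -/

instance instContinuousSMulPt : ContinuousSMul ℝ (Pt M₁ M₂) :=
  IsBoundedSMul.continuousSMul

/-- The mean value inequality on the segment gives `C` in place of the sharp `C/2`, which the
constants of the theorem tolerate. General targets allow its use both for `J` and for the gradients
of the `J_k`. -/
theorem norm_taylor_le {E F : Type*} [NormedAddCommGroup E] [NormedSpace ℝ E]
    [NormedAddCommGroup F] [NormedSpace ℝ F] {f : E → F} (hf : Differentiable ℝ f) {C : ℝ}
    (hC : 0 ≤ C) {z w : E} (h : ∀ v, ‖fderiv ℝ f v - fderiv ℝ f z‖ ≤ C * ‖v - z‖) :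
    ‖f w - f z - fderiv ℝ f z (w - z)‖ ≤ C * ‖w - z‖ ^ 2 := by
  have := (convex_segment z w).norm_image_sub_le_of_norm_fderiv_le' (𝕜 := ℝ) (f := f)
    (φ := fderiv ℝ f z) (C := C * ‖w - z‖) (fun x _ => hf x) (fun x hx => (h x).trans ?_)
    (left_mem_segment ℝ z w) (right_mem_segment ℝ z w)
  · rw [pow_two, ← mul_assoc]; exact this
  · exact mul_le_mul_of_nonneg_left (norm_sub_le_of_mem_segment hx) hC

theorem fderiv_apply_eq_inner_grad (f : Pt M₁ M₂ → ℝ) (z v : Pt M₁ M₂) :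
    fderiv ℝ f z v = inner ℝ (grad f z) v := by
  rw [grad, inner_gradient_left]

theorem norm_fderiv_sub_eq (f : Pt M₁ M₂ → ℝ) (z w : Pt M₁ M₂) :
    ‖fderiv ℝ f z - fderiv ℝ f w‖ = ‖grad f z - grad f w‖ := by
  rw [grad, grad, ← toDual_gradient, ← toDual_gradient, ← map_sub, LinearIsometryEquiv.norm_map]

theorem abs_taylor_le {f : Pt M₁ M₂ → ℝ} (hf : Differentiable ℝ f) {L : ℝ} (hL : 0 ≤ L)
    (h : ∀ z w, ‖grad f z - grad f w‖ ≤ L * ‖z - w‖) (z w : Pt M₁ M₂) :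
    |f w - f z - inner ℝ (grad f z) (w - z)| ≤ L * ‖w - z‖ ^ 2 := by
  have := norm_taylor_le (w := w) (z := z) hf hL
    (fun v => by rw [norm_fderiv_sub_eq]; exact h v z)
  rwa [fderiv_apply_eq_inner_grad] at this

theorem norm_fst_le' (z : Pt M₁ M₂) : ‖z.fst‖ ≤ ‖z‖ := WithLp.norm_fst_le _ z
theorem norm_snd_le' (z : Pt M₁ M₂) : ‖z.snd‖ ≤ ‖z‖ := WithLp.norm_snd_le _ z

theorem inner_pt (z w : Pt M₁ M₂) :
    inner ℝ z w = inner ℝ z.fst w.fst + inner ℝ z.snd w.snd := WithLp.prod_inner_apply _ _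

theorem norm_sq_pt (z : Pt M₁ M₂) : ‖z‖ ^ 2 = ‖z.fst‖ ^ 2 + ‖z.snd‖ ^ 2 :=
  WithLp.prod_norm_sq_eq_of_L2 _

@[simp] theorem pt_fst (x : EuclideanSpace ℝ (Fin M₁)) (y : EuclideanSpace ℝ (Fin M₂)) :
    (pt x y).fst = x := rfl
@[simp] theorem pt_snd (x : EuclideanSpace ℝ (Fin M₁)) (y : EuclideanSpace ℝ (Fin M₂)) :
    (pt x y).snd = y := rfl
@[simp] theorem pt_eta (z : Pt M₁ M₂) : pt z.fst z.snd = z := rfl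

theorem continuous_pt : Continuous (fun q : EuclideanSpace ℝ (Fin M₁) × EuclideanSpace ℝ (Fin M₂) =>
    pt q.1 q.2) := WithLp.prod_continuous_toLp 2 _ _

theorem norm_unit_le {E : Type*} [NormedAddCommGroup E] [NormedSpace ℝ E] (v : E) :
    ‖unit v‖ ≤ 1 := by
  rw [unit, norm_smul, norm_inv, norm_norm]; exact inv_mul_le_one

/-- Since `⟪m, unit m⟫ = ‖m‖`, one `‖m - g‖` is lost in replacing `m` by `g` in the inner product
and one in replacing `‖m‖` by `‖g‖`. The case `m = 0` is covered. -/
theorem norm_sub_two_mul_le_inner_unit {E : Type*} [NormedAddCommGroup E] [InnerProductSpace ℝ E]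
    (g m : E) : ‖g‖ - 2 * ‖m - g‖ ≤ inner ℝ g (unit m) := by
  have h1 : inner ℝ m (unit m) = ‖m‖ := by
    rw [unit, real_inner_smul_right, real_inner_self_eq_norm_sq]
    rcases eq_or_ne ‖m‖ 0 with h | h
    · simp [h]
    · field_simp
  have h2 : inner ℝ (m - g) (unit m) ≤ ‖m - g‖ :=
    (real_inner_le_norm _ _).trans (mul_le_of_le_one_right (norm_nonneg _) (norm_unit_le m))
  rw [inner_sub_left, h1] at h2
  have h3 : ‖g‖ ≤ ‖m‖ + ‖m - g‖ := by
    have := norm_sub_le m (m - g); rwa [sub_sub_cancel] at this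
  linarith

end Smooth

/-! ### Pathwise descent of the envelope and of the gap under the PL condition. -/

section Cost

variable {M₁ M₂ K : ℕ} {Ξ : Type*} [MeasurableSpace Ξ] {prob : Problem M₁ M₂ K Ξ}
  {Lf Lh σ σh ν : ℝ}

theorem envelope_eq {x : EuclideanSpace ℝ (Fin M₁)} {y : EuclideanSpace ℝ (Fin M₂)}
    (hy : y ∈ prob.argmax x) : prob.envelope x = prob.cost (pt x y) :=
  le_antisymm (ciSup_le fun y' => hy y')
    (le_ciSup (f := fun y => prob.cost (pt x y)) ⟨_, by rintro _ ⟨y', rfl⟩; exact hy y'⟩ y)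

theorem mem_argmax_of_gap_le {z : Pt M₁ M₂} (hne : (prob.argmax z.fst).Nonempty)
    (h : prob.gap z ≤ 0) : z.snd ∈ prob.argmax z.fst := by
  obtain ⟨y, hy⟩ := hne
  intro y'
  have := envelope_eq hy
  rw [Problem.gap, this] at h
  rw [pt_eta]
  linarith [hy y']

theorem cost_le_envelope {z : Pt M₁ M₂} (hne : (prob.argmax z.fst).Nonempty) :
    prob.cost z ≤ prob.envelope z.fst := by
  obtain ⟨y, hy⟩ := hne
  rw [envelope_eq hy]; exact hy z.snd

theorem gap_nonneg {z : Pt M₁ M₂} (hne : (prob.argmax z.fst).Nonempty) : 0 ≤ prob.gap z :=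
  sub_nonneg.2 (cost_le_envelope hne)

theorem hasGradientAt_cost (hd : ∀ k, Differentiable ℝ (prob.localCost k)) (z : Pt M₁ M₂) :
    HasGradientAt prob.cost ((1 / (K : ℝ)) • ∑ k, grad (prob.localCost k) z) z := by
  have h : HasFDerivAt prob.cost ((1 / (K : ℝ)) • ∑ k, fderiv ℝ (prob.localCost k) z) z :=
    (HasFDerivAt.fun_sum fun k _ => (hd k z).hasFDerivAt).const_mul _
  rw [hasGradientAt_iff_hasFDerivAt, map_smul, map_sum]
  simpa only [grad, toDual_gradient] using h

theorem grad_cost (hd : ∀ k, Differentiable ℝ (prob.localCost k)) (z : Pt M₁ M₂) :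
    grad prob.cost z = (1 / (K : ℝ)) • ∑ k, grad (prob.localCost k) z :=
  (hasGradientAt_cost hd z).gradient

theorem differentiable_cost (hd : ∀ k, Differentiable ℝ (prob.localCost k)) :
    Differentiable ℝ prob.cost := fun z => (hasGradientAt_cost hd z).differentiableAt

theorem norm_average_le {E : Type*} [NormedAddCommGroup E] [NormedSpace ℝ E] (hK : 0 < K)
    {v : Fin K → E} {C : ℝ} (h : ∀ k, ‖v k‖ ≤ C) : ‖(1 / (K : ℝ)) • ∑ k, v k‖ ≤ C := by
  have hK' : (0 : ℝ) < K := by exact_mod_cast hK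
  rw [norm_smul, Real.norm_of_nonneg (by positivity)]
  have := norm_sum_le_of_le Finset.univ (fun k _ => h k)
  simp only [Finset.sum_const, Finset.card_univ, Fintype.card_fin, nsmul_eq_mul] at this
  rw [div_mul_eq_mul_div, one_mul, div_le_iff₀ hK']
  linarith

theorem norm_grad_cost_sub_le (hK : 0 < K) (hd : ∀ k, Differentiable ℝ (prob.localCost k))
    (h : ∀ k z₁ z₂, ‖grad (prob.localCost k) z₁ - grad (prob.localCost k) z₂‖ ≤ Lf * ‖z₁ - z₂‖)
    (z₁ z₂ : Pt M₁ M₂) : ‖grad prob.cost z₁ - grad prob.cost z₂‖ ≤ Lf * ‖z₁ - z₂‖ := by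
  rw [grad_cost hd, grad_cost hd, ← smul_sub, ← Finset.sum_sub_distrib]
  exact norm_average_le hK fun k => h k z₁ z₂

theorem norm_sub_pt_le {z w : Pt M₁ M₂} : ‖z - w‖ ≤ ‖z.fst - w.fst‖ + ‖z.snd - w.snd‖ := by
  have h := norm_sq_pt (z - w)
  rw [WithLp.sub_fst, WithLp.sub_snd] at h
  refine abs_le_of_sq_le_sq' ?_ (by positivity) |>.2
  nlinarith [norm_nonneg (z.fst - w.fst), norm_nonneg (z.snd - w.snd)]

/-- The properties of the cost `J` that the pathwise analysis of the iterates uses. -/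
structure SmoothPL (prob : Problem M₁ M₂ K Ξ) (Lf ν : ℝ) : Prop where
  Lf_pos : 0 < Lf
  ν_pos : 0 < ν
  diff : Differentiable ℝ prob.cost
  lip : ∀ z w, ‖grad prob.cost z - grad prob.cost w‖ ≤ Lf * ‖z - w‖
  cond : prob.CostConditions ν

theorem Problem.Assumptions.differentiable_localCost (h : prob.Assumptions Lf Lh σ σh ν)
    (k : Fin K) : Differentiable ℝ (prob.localCost k) :=
  (h.lipschitz.contDiff k).differentiable (by norm_num)

theorem Problem.Assumptions.smoothPL (h : prob.Assumptions Lf Lh σ σh ν) (hK : 0 < K) :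
    SmoothPL prob Lf ν where
  Lf_pos := h.Lf_pos
  ν_pos := h.ν_pos
  diff := differentiable_cost h.differentiable_localCost
  lip := norm_grad_cost_sub_le hK h.differentiable_localCost h.lipschitz.smooth
  cond := h.costCond

namespace SmoothPL

theorem gap_nonneg (h : SmoothPL prob Lf ν) (z : Pt M₁ M₂) : 0 ≤ prob.gap z :=
  FedMiMA.gap_nonneg (h.cond.max_attained _)

theorem gap_ascent_le (h : SmoothPL prob Lf ν) (z : Pt M₁ M₂) (t : ℝ) :
    prob.gap (pt z.fst (z.snd + t • (grad prob.cost z).snd))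
      ≤ prob.gap z - (t - Lf * t ^ 2) * ‖(grad prob.cost z).snd‖ ^ 2 := by
  set g := (grad prob.cost z).snd
  set w := pt z.fst (z.snd + t • g) with hw
  have h1 := abs_taylor_le h.diff h.Lf_pos.le h.lip z w
  have h2 : inner ℝ (grad prob.cost z) (w - z) = t * ‖g‖ ^ 2 := by
    rw [inner_pt, WithLp.sub_fst, WithLp.sub_snd, hw, pt_fst, pt_snd, sub_self, inner_zero_right,
      add_sub_cancel_left, real_inner_smul_right, real_inner_self_eq_norm_sq, zero_add]
  have h3 : ‖w - z‖ ^ 2 = t ^ 2 * ‖g‖ ^ 2 := by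
    rw [norm_sq_pt, WithLp.sub_fst, WithLp.sub_snd, hw, pt_fst, pt_snd, sub_self, norm_zero,
      add_sub_cancel_left, norm_smul, mul_pow, Real.norm_eq_abs, sq_abs]
    ring
  rw [h2, h3] at h1
  have h4 := (abs_le.1 h1).1
  have h5 : prob.gap w = prob.envelope z.fst - prob.cost w := rfl
  rw [h5, Problem.gap]
  nlinarith

theorem pl_gap (h : SmoothPL prob Lf ν) (z : Pt M₁ M₂) :
    2 * ν * prob.gap z ≤ ‖(grad prob.cost z).snd‖ ^ 2 := h.cond.pl z

theorem sqrt_gap_le (h : SmoothPL prob Lf ν) (z : Pt M₁ M₂) :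
    √(2 * ν) * √(prob.gap z) ≤ ‖(grad prob.cost z).snd‖ := by
  rw [← Real.sqrt_mul (by linarith [h.ν_pos])]
  exact Real.sqrt_le_left (norm_nonneg _) |>.2 (h.pl_gap z)

theorem continuous_gap_pt (h : SmoothPL prob Lf ν) (x : EuclideanSpace ℝ (Fin M₁)) :
    Continuous fun y => prob.gap (pt x y) := by
  have : Continuous fun y : EuclideanSpace ℝ (Fin M₂) => pt x y :=
    continuous_pt.comp (Continuous.prodMk_right x)
  show Continuous fun y => prob.envelope x - prob.cost (pt x y)
  exact continuous_const.sub (h.diff.continuous.comp this)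

/-- The PL condition bounds the distance to the maximizers by the gradient. -/
theorem exists_argmax_near (h : SmoothPL prob Lf ν) (z : Pt M₁ M₂) :
    ∃ y ∈ prob.argmax z.fst, ‖y - z.snd‖ ≤ 2 / ν * ‖(grad prob.cost z).snd‖ := by
  have hν := h.ν_pos
  have hL := h.Lf_pos
  set S := √(2 * ν) with hS
  have hSp : 0 < S := Real.sqrt_pos.2 (by linarith)
  have hS2 : S ^ 2 = 2 * ν := Real.sq_sqrt (by linarith)
  -- A variational argument replaces the gradient flow: a minimizer of this penalized root gap is
  -- shown to be critical in `y`, hence a maximizer by PL, and comparing its value with that at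
  -- `z.snd` bounds the distance.
  set Φ : EuclideanSpace ℝ (Fin M₂) → ℝ :=
    fun y => 4 / S * √(prob.gap (pt z.fst y)) + ‖y - z.snd‖ with hΦ
  have hc : Continuous Φ :=
    (continuous_const.mul (h.continuous_gap_pt z.fst).sqrt).add (by fun_prop)
  -- The distance term makes `Φ` coercive, so a global minimizer exists.
  have hev : ∀ᶠ y in Filter.cocompact (EuclideanSpace ℝ (Fin M₂)), Φ z.snd ≤ Φ y := by
    filter_upwards [(tendsto_dist_right_cocompact_atTop z.snd).eventually_ge_atTop (Φ z.snd)]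
      with y hy
    rw [dist_eq_norm] at hy
    exact hy.trans (le_add_of_nonneg_left (by positivity))
  obtain ⟨y, hy⟩ := hc.exists_forall_le' z.snd hev
  set g := (grad prob.cost (pt z.fst y)).snd with hg
  have hg0 : g = 0 := by
    by_contra hne
    have hgp : 0 < ‖g‖ := norm_pos_iff.2 hne
    -- At a noncritical minimizer, an ascent step `1/(4Lf)` lowers the gap by at least
    -- `3‖g‖²/(16Lf)`, while minimality of `Φ` together with PL caps the decrease at `2‖g‖²/(16Lf)`.
    have h1 := h.gap_ascent_le (pt z.fst y) (1 / (4 * Lf))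
    rw [pt_fst, pt_snd, ← hg] at h1
    have h2 := hy (y + (1 / (4 * Lf)) • g)
    have h3 := h.sqrt_gap_le (pt z.fst y)
    rw [← hg, ← hS] at h3
    simp only [hΦ] at h2
    have h4 : ‖y + (1 / (4 * Lf)) • g - z.snd‖ ≤ ‖y - z.snd‖ + 1 / (4 * Lf) * ‖g‖ := by
      rw [add_sub_right_comm]
      refine (norm_add_le _ _).trans_eq ?_
      rw [norm_smul, Real.norm_of_nonneg (by positivity)]
    have ha2 := Real.sq_sqrt (h.gap_nonneg (pt z.fst y))
    have hb2 := Real.sq_sqrt (h.gap_nonneg (pt z.fst (y + (1 / (4 * Lf)) • g)))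
    set a := √(prob.gap (pt z.fst y))
    set b := √(prob.gap (pt z.fst (y + (1 / (4 * Lf)) • g)))
    rw [← ha2, ← hb2] at h1
    have ha : 0 ≤ a := Real.sqrt_nonneg _
    have hb : 0 ≤ b := Real.sqrt_nonneg _
    have e1 : 1 / (4 * Lf) - Lf * (1 / (4 * Lf)) ^ 2 = 3 / (16 * Lf) := by field_simp; norm_num
    rw [e1] at h1
    have h5 : (a - b) * (16 * Lf) ≤ S * ‖g‖ := by
      have : 4 / S * (a - b) ≤ 1 / (4 * Lf) * ‖g‖ := by linarith
      rw [div_mul_eq_mul_div, div_le_iff₀ hSp, div_mul_eq_mul_div, div_mul_eq_mul_div,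
        le_div_iff₀ (by positivity)] at this
      linarith
    have h6 : 3 * ‖g‖ ^ 2 ≤ (a ^ 2 - b ^ 2) * (16 * Lf) := by
      have : 3 / (16 * Lf) * ‖g‖ ^ 2 ≤ a ^ 2 - b ^ 2 := by linarith
      rwa [div_mul_eq_mul_div, div_le_iff₀ (by positivity)] at this
    have h7 : 0 < a - b := by
      have : 0 < a ^ 2 - b ^ 2 := by
        by_contra hcon
        nlinarith [pow_pos hgp 2]
      nlinarith
    have h8 : (a ^ 2 - b ^ 2) * (16 * Lf) ≤ 2 * ‖g‖ ^ 2 := by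
      calc (a ^ 2 - b ^ 2) * (16 * Lf) = ((a - b) * (16 * Lf)) * (a + b) := by ring
        _ ≤ (S * ‖g‖) * (2 * a) := by
            apply mul_le_mul h5 (by linarith) (by linarith) (by positivity)
        _ = 2 * (‖g‖ * (S * a)) := by ring
        _ ≤ 2 * (‖g‖ * ‖g‖) := by gcongr
        _ = 2 * ‖g‖ ^ 2 := by ring
    nlinarith [pow_pos hgp 2]
  have hgap : prob.gap (pt z.fst y) ≤ 0 := by
    have := h.pl_gap (pt z.fst y)
    rw [← hg, hg0, norm_zero] at this
    nlinarith
  refine ⟨y, mem_argmax_of_gap_le (z := pt z.fst y) (h.cond.max_attained _) hgap, ?_⟩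
  have h1 := hy z.snd
  simp only [hΦ, sub_self, norm_zero, add_zero, pt_eta] at h1
  have h2 : ‖y - z.snd‖ ≤ 4 / S * √(prob.gap z) :=
    (le_add_of_nonneg_left (by positivity)).trans h1
  refine h2.trans ?_
  have h3 := h.sqrt_gap_le z
  rw [← hS] at h3
  calc 4 / S * √(prob.gap z) = 4 / S ^ 2 * (S * √(prob.gap z)) := by field_simp
    _ ≤ 4 / S ^ 2 * ‖(grad prob.cost z).snd‖ := by gcongr
    _ = 2 / ν * ‖(grad prob.cost z).snd‖ := by rw [hS2]; field_simp; norm_num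

/-- An ascent step `1/(2Lf)` cannot gain more than the gap, so `‖∇_y J‖² ≤ 4Lf · gap`, while PL
gives `2ν · gap ≤ ‖∇_y J‖²`. For `κ < 1/2` both are compatible only with zero gap. This settles the
degenerate range of `κ` in the explicit bound, where `κ ≥ 1` is not assumed. -/
theorem grad_snd_eq_zero (h : SmoothPL prob Lf ν) (hκ : Lf / ν < 1 / 2) (z : Pt M₁ M₂) :
    (grad prob.cost z).snd = 0 := by
  have hν := h.ν_pos
  have hL := h.Lf_pos
  have h0 := h.gap_nonneg (pt z.fst (z.snd + (1 / (2 * Lf)) • (grad prob.cost z).snd))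
  have h1 := h0.trans (h.gap_ascent_le z (1 / (2 * Lf)))
  have e1 : 1 / (2 * Lf) - Lf * (1 / (2 * Lf)) ^ 2 = 1 / (4 * Lf) := by field_simp; norm_num
  rw [e1, sub_nonneg, div_mul_eq_mul_div, div_le_iff₀ (by positivity)] at h1
  have h2 := h.pl_gap z
  rw [div_lt_iff₀ hν] at hκ
  have h3 : prob.gap z ≤ 0 := by
    by_contra hc
    push Not at hc
    nlinarith
  have h4 : ‖(grad prob.cost z).snd‖ ^ 2 ≤ 0 := by nlinarith
  have : ‖(grad prob.cost z).snd‖ = 0 := by nlinarith [norm_nonneg (grad prob.cost z).snd]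
  exact norm_eq_zero.1 this

theorem norm_pt_sub_fst (x x' : EuclideanSpace ℝ (Fin M₁)) (y : EuclideanSpace ℝ (Fin M₂)) :
    ‖pt x' y - pt x y‖ = ‖x' - x‖ := by
  refine (sq_eq_sq₀ (norm_nonneg _) (norm_nonneg _)).1 ?_
  rw [norm_sq_pt]; simp

theorem norm_pt_sub_snd (x : EuclideanSpace ℝ (Fin M₁)) (y y' : EuclideanSpace ℝ (Fin M₂)) :
    ‖pt x y' - pt x y‖ = ‖y' - y‖ := by
  refine (sq_eq_sq₀ (norm_nonneg _) (norm_nonneg _)).1 ?_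
  rw [norm_sq_pt]; simp

/-- With `y'` a maximizer for `x'` near `z.snd`, `P(x') = J(x', y')` and `P(x) ≥ J(x, y')`, so a
Taylor expansion in `x` at fixed `y'` suffices. Replacing `∇_x J(x, y')` by `∇_x J(z)` costs `Lf ‖y'
- z.snd‖`, which produces the `κ` terms. This one-sided estimate takes the place of smoothness of
`P`. -/
theorem envelope_sub_le (h : SmoothPL prob Lf ν) (z : Pt M₁ M₂) (x' : EuclideanSpace ℝ (Fin M₁)) :
    prob.envelope x' - prob.envelope z.fst ≤ inner ℝ (grad prob.cost z).fst (x' - z.fst)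
      + 2 * (Lf / ν) * ‖x' - z.fst‖ * ‖(grad prob.cost z).snd‖
      + (1 + 2 * (Lf / ν)) * Lf * ‖x' - z.fst‖ ^ 2 := by
  have hν := h.ν_pos
  have hL := h.Lf_pos
  obtain ⟨y', hy', hd⟩ := h.exists_argmax_near (pt x' z.snd)
  simp only [pt_fst, pt_snd] at hy' hd
  set d := ‖x' - z.fst‖ with hdef
  have h1 : ‖(grad prob.cost (pt x' z.snd)).snd‖ ≤ ‖(grad prob.cost z).snd‖ + Lf * d := by
    have := (norm_snd_le' _).trans (h.lip (pt x' z.snd) z)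
    have e : ‖pt x' z.snd - z‖ = d := norm_pt_sub_fst z.fst x' z.snd
    rw [e, WithLp.sub_snd] at this
    have h2 := norm_le_insert' (grad prob.cost (pt x' z.snd)).snd (grad prob.cost z).snd
    linarith
  have h2 := abs_taylor_le h.diff hL.le h.lip (pt z.fst y') (pt x' y')
  rw [norm_pt_sub_fst, inner_pt] at h2
  simp only [WithLp.sub_fst, WithLp.sub_snd, pt_fst, pt_snd, sub_self, inner_zero_right,
    add_zero] at h2
  have h3 : prob.cost (pt z.fst y') ≤ prob.envelope z.fst :=
    cost_le_envelope (z := pt z.fst y') (h.cond.max_attained _)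
  have h4 : inner ℝ ((grad prob.cost (pt z.fst y')).fst - (grad prob.cost z).fst) (x' - z.fst)
      ≤ 2 * (Lf / ν) * (‖(grad prob.cost z).snd‖ + Lf * d) * d := by
    refine (real_inner_le_norm _ _).trans ?_
    gcongr
    rw [← WithLp.sub_fst]
    refine (norm_fst_le' _).trans ((h.lip _ _).trans ?_)
    have e : ‖pt z.fst y' - z‖ = ‖y' - z.snd‖ := norm_pt_sub_snd z.fst z.snd y'
    rw [e]
    calc Lf * ‖y' - z.snd‖ ≤ Lf * (2 / ν * (‖(grad prob.cost z).snd‖ + Lf * d)) := by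
          gcongr; exact hd.trans (by gcongr)
      _ = _ := by ring
  rw [inner_sub_left] at h4
  rw [envelope_eq hy']
  have := (abs_le.1 h2).2
  linarith

/-- One server step along a direction `m`: decrease of `P`, and of the gap. -/
theorem step_le (h : SmoothPL prob Lf ν) {a b : ℝ} (ha : 0 ≤ a) (hb : 0 ≤ b) (z m : Pt M₁ M₂) :
    a * ‖(grad prob.cost z).fst‖ ≤ prob.envelope z.fst - prob.envelope (gdaStep a b z m).fst
        + 2 * a * ‖m - grad prob.cost z‖ + 2 * (Lf / ν) * a * ‖(grad prob.cost z).snd‖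
        + (1 + 2 * (Lf / ν)) * Lf * a ^ 2 ∧
    b * ‖(grad prob.cost z).snd‖ ≤ prob.gap z - prob.gap (gdaStep a b z m)
        + 2 * b * ‖m - grad prob.cost z‖ + 2 * (Lf / ν) * a * ‖(grad prob.cost z).snd‖
        + (2 + 2 * (Lf / ν)) * Lf * a ^ 2 + Lf * b ^ 2 := by
  have hν := h.ν_pos
  have hL := h.Lf_pos
  set G := grad prob.cost z with hG
  set w := gdaStep a b z m with hw
  have wf : w.fst - z.fst = -(a • unit m.fst) := by simp [hw, gdaStep]
  have ws : w.snd - z.snd = b • unit m.snd := by simp [hw, gdaStep]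
  have hda : ‖w.fst - z.fst‖ ≤ a := by
    rw [wf, norm_neg, norm_smul, Real.norm_of_nonneg ha]
    exact mul_le_of_le_one_right ha (norm_unit_le _)
  have hdb : ‖w.snd - z.snd‖ ≤ b := by
    rw [ws, norm_smul, Real.norm_of_nonneg hb]
    exact mul_le_of_le_one_right hb (norm_unit_le _)
  have h1 := h.envelope_sub_le z w.fst
  have hκ : 0 ≤ Lf / ν := by positivity
  have h1' : prob.envelope w.fst - prob.envelope z.fst ≤ inner ℝ G.fst (w.fst - z.fst)
      + 2 * (Lf / ν) * a * ‖G.snd‖ + (1 + 2 * (Lf / ν)) * Lf * a ^ 2 := by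
    refine h1.trans ?_
    gcongr
  have ex : ‖m.fst - G.fst‖ ≤ ‖m - G‖ := norm_fst_le' (m - G)
  have ey : ‖m.snd - G.snd‖ ≤ ‖m - G‖ := norm_snd_le' (m - G)
  have ix : inner ℝ G.fst (w.fst - z.fst) ≤ -(a * ‖G.fst‖) + 2 * a * ‖m - G‖ := by
    rw [wf, inner_neg_right, real_inner_smul_right]
    nlinarith [norm_sub_two_mul_le_inner_unit G.fst m.fst]
  have iy : b * ‖G.snd‖ - 2 * b * ‖m - G‖ ≤ inner ℝ G.snd (w.snd - z.snd) := by
    rw [ws, real_inner_smul_right]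
    nlinarith [norm_sub_two_mul_le_inner_unit G.snd m.snd]
  have h2 := (abs_le.1 (abs_taylor_le h.diff hL.le h.lip z w)).1
  rw [inner_pt, norm_sq_pt, WithLp.sub_fst, WithLp.sub_snd, ← hG] at h2
  have h3 : Lf * (‖w.fst - z.fst‖ ^ 2 + ‖w.snd - z.snd‖ ^ 2) ≤ Lf * (a ^ 2 + b ^ 2) := by gcongr
  refine ⟨by linarith, ?_⟩
  -- The term `⟪∇_x J, x' - x⟫` appears in the bounds for both `P` and `J` and cancels in the gap,
  -- so no `‖∇_x J‖` enters the second inequality.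
  simp only [Problem.gap]
  linarith

theorem envelopeInf_le (h : SmoothPL prob Lf ν) (x : EuclideanSpace ℝ (Fin M₁)) :
    prob.envelopeInf ≤ prob.envelope x := ciInf_le h.cond.bddBelow x

/-- Pathwise bound on the stationarity measure along server steps `z` with directions `m`. -/
theorem sum_stat_le (h : SmoothPL prob Lf ν) {a b : ℝ} (ha : 0 < a) (hab : a ≤ b / (6 * (Lf / ν)))
    (z m : ℕ → Pt M₁ M₂) (hz : ∀ i, z (i + 1) = gdaStep a b (z i) (m i)) (T : ℕ) :
    ∑ i ∈ Finset.range T, (‖(grad prob.cost (z i)).fst‖ + ‖(grad prob.cost (z i)).snd‖)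
      ≤ (prob.envelope (z 0).fst - prob.envelopeInf) / a + 6 * (Lf / ν) * prob.gap (z 0) / b
        + (2 + 12 * (Lf / ν)) * ∑ i ∈ Finset.range T, ‖m i - grad prob.cost (z i)‖
        + T * Lf * (1 + 8 * (Lf / ν)) * a + 6 * (Lf / ν) * T * Lf * b := by
  have hν := h.ν_pos
  have hL := h.Lf_pos
  set κ := Lf / ν with hκdef
  have hκ : 0 < κ := by positivity
  rw [le_div_iff₀ (by positivity)] at hab
  have hb : 0 < b := lt_of_lt_of_le (by positivity) hab
  set X := ∑ i ∈ Finset.range T, ‖(grad prob.cost (z i)).fst‖ with hX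
  set Y := ∑ i ∈ Finset.range T, ‖(grad prob.cost (z i)).snd‖ with hY
  set E := ∑ i ∈ Finset.range T, ‖m i - grad prob.cost (z i)‖ with hE
  have hX0 : 0 ≤ X := Finset.sum_nonneg fun _ _ => norm_nonneg _
  have hY0 : 0 ≤ Y := Finset.sum_nonneg fun _ _ => norm_nonneg _
  have hE0 : 0 ≤ E := Finset.sum_nonneg fun _ _ => norm_nonneg _
  have hP0 := h.envelopeInf_le (z T).fst
  have hΔ0 := h.gap_nonneg (z T)
  have sX : a * X ≤ prob.envelope (z 0).fst - prob.envelope (z T).fst + 2 * a * E + 2 * κ * a * Y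
      + T * ((1 + 2 * κ) * Lf * a ^ 2) := by
    have := Finset.sum_le_sum fun i (_ : i ∈ Finset.range T) =>
      (h.step_le ha.le hb.le (z i) (m i)).1
    simp only [← hz, Finset.sum_add_distrib, ← Finset.mul_sum, Finset.sum_const,
      Finset.card_range, nsmul_eq_mul] at this
    rw [Finset.sum_range_sub' (fun i => prob.envelope (z i).fst), ← hX, ← hE, ← hY, ← hκdef] at this
    linarith
  have sY : b * Y ≤ prob.gap (z 0) - prob.gap (z T) + 2 * b * E + 2 * κ * a * Y
      + T * ((2 + 2 * κ) * Lf * a ^ 2) + T * (Lf * b ^ 2) := by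
    have := Finset.sum_le_sum fun i (_ : i ∈ Finset.range T) =>
      (h.step_le ha.le hb.le (z i) (m i)).2
    simp only [← hz, Finset.sum_add_distrib, ← Finset.mul_sum, Finset.sum_const,
      Finset.card_range, nsmul_eq_mul] at this
    rw [Finset.sum_range_sub' (fun i => prob.gap (z i)), ← hE, ← hY, ← hκdef] at this
    linarith
  rw [Finset.sum_add_distrib, ← hX, ← hY]
  have hX1 : X ≤ (prob.envelope (z 0).fst - prob.envelopeInf) / a + 2 * E + 2 * κ * Y
      + T * ((1 + 2 * κ) * Lf * a) := by
    rw [← mul_le_mul_iff_right₀ ha]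
    have : a * ((prob.envelope (z 0).fst - prob.envelopeInf) / a)
      = prob.envelope (z 0).fst - prob.envelopeInf := by field_simp
    nlinarith
  have hT : (0 : ℝ) ≤ T := T.cast_nonneg
  have hg0 := h.gap_nonneg (z 0)
  rcases lt_or_ge κ (1 / 2) with hlt | hge
  -- For `κ < 1/2` the absorption used below is not available, but the `y` gradients vanish
  -- identically.
  · have hY' : Y = 0 := Finset.sum_eq_zero fun i _ => by
      rw [h.grad_snd_eq_zero hlt (z i), norm_zero]
    rw [hY'] at hX1 ⊢
    have p1 : 0 ≤ 6 * κ * prob.gap (z 0) / b := by positivity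
    have p2 : 0 ≤ 6 * κ * T * Lf * b := by positivity
    have p3 : 0 ≤ κ * E := by positivity
    have p4 : 0 ≤ T * Lf * κ * a := by positivity
    linarith
  -- Here `κ ≥ 1/2` enters through `2 + 2κ ≤ 6κ`.
  · have hq : (2 + 2 * κ) * a ≤ b := by nlinarith
    have hY1 : Y ≤ 3 / 2 * (prob.gap (z 0) / b) + 3 * E + 3 / 2 * T * Lf * (a + b) := by
      rw [← mul_le_mul_iff_right₀ hb]
      have e1 : b * (3 / 2 * (prob.gap (z 0) / b) + 3 * E + 3 / 2 * T * Lf * (a + b))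
        = 3 / 2 * prob.gap (z 0) + 3 * b * E + 3 / 2 * (T * Lf) * a * b
          + 3 / 2 * (T * Lf) * b ^ 2 := by field_simp; ring
      rw [e1]
      -- The cross term `2κaY` is at most `bY/3`; moving it to the left leaves `2bY/3`, whence the
      -- factors `3/2` and `3`.
      have e2 : κ * a * Y ≤ b / 6 * Y := by gcongr; linarith
      have e3 : T * ((2 + 2 * κ) * Lf * a ^ 2) ≤ T * Lf * a * b := by
        have : (T * Lf * a) * ((2 + 2 * κ) * a) ≤ (T * Lf * a) * b := by gcongr
        linarith
      linarith
    have hk : 1 + 2 * κ ≤ 4 * κ := by linarith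
    have hY2 : (1 + 2 * κ) * Y ≤ 4 * κ * (3 / 2 * (prob.gap (z 0) / b) + 3 * E
        + 3 / 2 * T * Lf * (a + b)) := by gcongr
    have e4 : 6 * κ * prob.gap (z 0) / b = 6 * κ * (prob.gap (z 0) / b) := by ring
    rw [e4]
    linarith

end SmoothPL
end Cost

/-! ### Independence by freezing a sample, and orthogonality of noise. -/

section Probability

variable {Ω Ξ α β ι E : Type*} [MeasurableSpace Ω] [MeasurableSpace Ξ] [MeasurableSpace α]
  [MeasurableSpace β] {ρ : Measure Ω}

/-- The overwritten family is measurable with respect to the samples other than `s`. This turns the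
statement that a quantity is unchanged when sample `s` is overwritten into independence of that
sample, without any filtration. -/
theorem indepFun_update_of_iIndepFun [DecidableEq ι] {ξ : ι → Ω → Ξ} (hξ : ∀ s, Measurable (ξ s))
    (hind : iIndepFun ξ ρ) (s : ι) (a : Ξ) :
    IndepFun (fun ω => Function.update (fun t => ξ t ω) s a) (ξ s) ρ := by
  have h := indep_iSup_of_disjoint (m := fun t => MeasurableSpace.comap (ξ t) inferInstance)
    (fun t => (hξ t).comap_le) hind.iIndep (S := {s}ᶜ) (T := {s}) disjoint_compl_left
  rw [IndepFun_iff_Indep]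
  refine indep_of_indep_of_le_left (indep_of_indep_of_le_right h ?_) ?_
  · exact le_iSup₂ (f := fun t (_ : t ∈ ({s} : Set ι)) =>
      MeasurableSpace.comap (ξ t) inferInstance) s rfl
  · rw [← measurable_iff_comap_le, @measurable_pi_iff]
    intro t
    by_cases hts : t = s
    · subst hts
      simp only [Function.update_self]
      exact measurable_const
    · simp only [Function.update_of_ne hts]
      rw [measurable_iff_comap_le]
      exact le_iSup₂ (f := fun t (_ : t ∈ ({s}ᶜ : Set ι)) =>
        MeasurableSpace.comap (ξ t) inferInstance) t hts

theorem integrable_inner_of_memLp_two {E : Type*} [NormedAddCommGroup E] [InnerProductSpace ℝ E]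
    {f g : Ω → E} (hf : MemLp f 2 ρ) (hg : MemLp g 2 ρ) :
    Integrable (fun ω => inner ℝ (f ω) (g ω)) ρ := by
  refine (hf.norm.integrable_mul hg.norm).mono
    (hf.aestronglyMeasurable.inner hg.aestronglyMeasurable) (.of_forall fun ω => ?_)
  simpa using norm_inner_le_norm (𝕜 := ℝ) (f ω) (g ω)

variable [IsProbabilityMeasure ρ]

/-- If `I` is independent of the pair `(X, Y)`, and `X` of `Y`, then `(I, X)` is independent
of `Y`. -/
theorem indepFun_prodMk_of_indepFun {I : Ω → α} {X : Ω → β} {Y : Ω → Ξ} (hI : Measurable I)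
    (hX : Measurable X) (hY : Measurable Y) (h : IndepFun I (fun ω => (X ω, Y ω)) ρ)
    (hXY : IndepFun X Y ρ) : IndepFun (fun ω => (I ω, X ω)) Y ρ := by
  have hIX : IndepFun I X ρ := h.comp measurable_id measurable_fst
  have : ∀ {γ : Type _} [MeasurableSpace γ] {f : Ω → γ}, Measurable f →
    IsProbabilityMeasure (ρ.map f) := fun hf => Measure.isProbabilityMeasure_map hf.aemeasurable
  have := this hI
  have := Measure.isProbabilityMeasure_map (μ := ρ) hX.aemeasurable
  have := Measure.isProbabilityMeasure_map (μ := ρ) hY.aemeasurable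
  rw [indepFun_iff_map_prod_eq_prod_map_map hI.aemeasurable (hX.prodMk hY).aemeasurable,
    (indepFun_iff_map_prod_eq_prod_map_map hX.aemeasurable hY.aemeasurable).1 hXY] at h
  rw [indepFun_iff_map_prod_eq_prod_map_map (hI.prodMk hX).aemeasurable hY.aemeasurable,
    (indepFun_iff_map_prod_eq_prod_map_map hI.aemeasurable hX.aemeasurable).1 hIX]
  -- After reassociating, both sides are the product of the three marginal laws.
  apply (MeasurableEquiv.prodAssoc (α := α) (β := β) (γ := Ξ)).map_measurableEquiv_injective
  rw [Measure.prodAssoc_prod, ← h,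
    Measure.map_map MeasurableEquiv.prodAssoc.measurable ((hI.prodMk hX).prodMk hY)]
  rfl

theorem indepFun_init_update [DecidableEq ι] {I : Ω → α} {ξ : ι → Ω → Ξ} (hI : Measurable I)
    (hξ : ∀ s, Measurable (ξ s)) (hind : iIndepFun ξ ρ) (hIξ : IndepFun I (fun ω s => ξ s ω) ρ)
    (s : ι) (a : Ξ) :
    IndepFun (fun ω => (I ω, Function.update (fun t => ξ t ω) s a)) (ξ s) ρ := by
  have hu : Measurable fun x : ι → Ξ => Function.update x s a :=
    measurable_pi_iff.2 fun t => by
      by_cases hts : t = s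
      · subst hts; simp only [Function.update_self]; exact measurable_const
      · simp only [Function.update_of_ne hts]; exact measurable_pi_apply t
  exact indepFun_prodMk_of_indepFun hI (hu.comp (measurable_pi_iff.2 hξ)) (hξ s)
    (hIξ.comp measurable_id (hu.prodMk (measurable_pi_apply s)))
    (indepFun_update_of_iIndepFun hξ hind s a)

/-- By independence the joint law is a product, and Fubini integrates the sample out first. The
variance bound is required only almost surely along `U`, as the bound on the initial displacement
holds only almost surely. -/
theorem memLp_two_noise {E : Type*} [NormedAddCommGroup E] [MeasurableSpace E] [BorelSpace E]
    [SecondCountableTopology E] {U : Ω → α} {X : Ω → Ξ} (hU : Measurable U) (hX : Measurable X)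
    (hind : IndepFun U X ρ) {B : α × Ξ → E} (hB : Measurable B) {V : ℝ}
    (hint : ∀ u, Integrable (fun x => ‖B (u, x)‖ ^ 2) (ρ.map X))
    (hV : ∀ᵐ ω ∂ρ, ∫ x, ‖B (U ω, x)‖ ^ 2 ∂(ρ.map X) ≤ V) :
    MemLp (fun ω => B (U ω, X ω)) 2 ρ ∧ ∫ ω, ‖B (U ω, X ω)‖ ^ 2 ∂ρ ≤ V := by
  have := Measure.isProbabilityMeasure_map (μ := ρ) hX.aemeasurable
  have := Measure.isProbabilityMeasure_map (μ := ρ) hU.aemeasurable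
  have hprod := (indepFun_iff_map_prod_eq_prod_map_map hU.aemeasurable hX.aemeasurable).1 hind
  have hm2 : Measurable fun q : α × Ξ => ‖B q‖ ^ 2 := hB.norm.pow_const 2
  have hmi : StronglyMeasurable fun u => ∫ x, ‖B (u, x)‖ ^ 2 ∂(ρ.map X) :=
    hm2.stronglyMeasurable.integral_prod_right'
  have hV' : ∀ᵐ u ∂(ρ.map U), ∫ x, ‖B (u, x)‖ ^ 2 ∂(ρ.map X) ≤ V :=
    (ae_map_iff hU.aemeasurable (measurableSet_le hmi.measurable measurable_const)).2 hV
  have hin : Integrable (fun u => ∫ x, ‖B (u, x)‖ ^ 2 ∂(ρ.map X)) (ρ.map U) := by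
    refine Integrable.of_bound hmi.aestronglyMeasurable V ?_
    filter_upwards [hV'] with u hu
    rwa [Real.norm_of_nonneg (integral_nonneg fun x => by positivity)]
  have hpi : Integrable (fun q => ‖B q‖ ^ 2) ((ρ.map U).prod (ρ.map X)) := by
    rw [integrable_prod_iff hm2.aestronglyMeasurable]
    refine ⟨.of_forall hint, ?_⟩
    simpa only [norm_pow, norm_norm] using hin
  have hI : Integrable (fun ω => ‖B (U ω, X ω)‖ ^ 2) ρ := by
    rw [← hprod] at hpi
    exact hpi.comp_measurable (hU.prodMk hX)
  refine ⟨(memLp_two_iff_integrable_sq_norm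
    (hB.comp (hU.prodMk hX)).aestronglyMeasurable).2 hI, ?_⟩
  calc ∫ ω, ‖B (U ω, X ω)‖ ^ 2 ∂ρ
      = ∫ q, ‖B q‖ ^ 2 ∂(ρ.map fun ω => (U ω, X ω)) :=
        (integral_map (hU.prodMk hX).aemeasurable hm2.aestronglyMeasurable).symm
    _ = ∫ u, ∫ x, ‖B (u, x)‖ ^ 2 ∂(ρ.map X) ∂(ρ.map U) := by rw [hprod, integral_prod _ hpi]
    _ ≤ ∫ _, V ∂(ρ.map U) := integral_mono_ae hin (integrable_const V) hV'
    _ = V := by simp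

variable [NormedAddCommGroup E] [InnerProductSpace ℝ E] [CompleteSpace E]
  [MeasurableSpace E] [BorelSpace E] [SecondCountableTopology E]

/-- Fubini plays the role of conditional expectation: for fixed `u` the inner integral is `⟪A u,
0⟫`. -/
theorem integral_inner_noise_eq_zero {U : Ω → α} {X : Ω → Ξ} (hU : Measurable U)
    (hX : Measurable X) (hind : IndepFun U X ρ) {A : α → E} {B : α × Ξ → E} (hA : Measurable A)
    (hB : Measurable B) (hint : ∀ u, Integrable (fun x => B (u, x)) (ρ.map X))
    (hmean : ∀ u, ∫ x, B (u, x) ∂(ρ.map X) = 0)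
    (hA2 : MemLp (fun ω => A (U ω)) 2 ρ) (hB2 : MemLp (fun ω => B (U ω, X ω)) 2 ρ) :
    ∫ ω, inner ℝ (A (U ω)) (B (U ω, X ω)) ∂ρ = 0 := by
  have := Measure.isProbabilityMeasure_map (μ := ρ) hX.aemeasurable
  have := Measure.isProbabilityMeasure_map (μ := ρ) hU.aemeasurable
  have hprod := (indepFun_iff_map_prod_eq_prod_map_map hU.aemeasurable hX.aemeasurable).1 hind
  have hm : Measurable fun q : α × Ξ => inner ℝ (A q.1) (B q) := (hA.comp measurable_fst).inner hB
  have hI : Integrable (fun ω => inner ℝ (A (U ω)) (B (U ω, X ω))) ρ :=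
    integrable_inner_of_memLp_two hA2 hB2
  have hpi : Integrable (fun q => inner ℝ (A q.1) (B q)) ((ρ.map U).prod (ρ.map X)) := by
    rw [← hprod]
    exact (integrable_map_measure hm.aestronglyMeasurable (hU.prodMk hX).aemeasurable).2 hI
  calc ∫ ω, inner ℝ (A (U ω)) (B (U ω, X ω)) ∂ρ
      = ∫ q, inner ℝ (A q.1) (B q) ∂(ρ.map fun ω => (U ω, X ω)) :=
        (integral_map (hU.prodMk hX).aemeasurable hm.aestronglyMeasurable).symm
    _ = ∫ u, ∫ x, inner ℝ (A u) (B (u, x)) ∂(ρ.map X) ∂(ρ.map U) := by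
        rw [hprod, integral_prod _ hpi]
    _ = 0 := by simp_rw [integral_inner (hint _), hmean, inner_zero_right, integral_zero]

/-- Expanding the square leaves only the diagonal, and Jensen passes from `L²` to `L¹`. -/
theorem integral_norm_sum_orthogonal_le {E : Type*} [NormedAddCommGroup E]
    [InnerProductSpace ℝ E] {S : Finset ι} {f : ι → Ω → E} {V : ι → ℝ}
    (hf : ∀ s ∈ S, MemLp (f s) 2 ρ) (hV : ∀ s ∈ S, ∫ ω, ‖f s ω‖ ^ 2 ∂ρ ≤ V s)
    (horth : ∀ s ∈ S, ∀ t ∈ S, s ≠ t → ∫ ω, inner ℝ (f s ω) (f t ω) ∂ρ = 0) :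
    ∫ ω, ‖∑ s ∈ S, f s ω‖ ∂ρ ≤ √(∑ s ∈ S, V s) := by
  have hF : MemLp (fun ω => ∑ s ∈ S, f s ω) 2 ρ := memLp_finsetSum S hf
  have h2 : ∫ ω, ‖∑ s ∈ S, f s ω‖ ^ 2 ∂ρ ≤ ∑ s ∈ S, V s := by
    have e : ∀ ω, ‖∑ s ∈ S, f s ω‖ ^ 2 = ∑ s ∈ S, ∑ t ∈ S, inner ℝ (f s ω) (f t ω) := fun ω => by
      rw [← real_inner_self_eq_norm_sq, sum_inner]
      simp_rw [inner_sum]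
    simp_rw [e]
    have hi : ∀ s ∈ S, ∀ t ∈ S, Integrable (fun ω => inner ℝ (f s ω) (f t ω)) ρ :=
      fun s hs t ht => integrable_inner_of_memLp_two (hf s hs) (hf t ht)
    rw [integral_finsetSum _ fun s hs => integrable_finsetSum _ fun t ht => hi s hs t ht]
    refine Finset.sum_le_sum fun s hs => ?_
    rw [integral_finsetSum _ fun t ht => hi s hs t ht]
    rw [Finset.sum_eq_single_of_mem s hs fun t ht hts => horth s hs t ht hts.symm]
    simpa only [real_inner_self_eq_norm_sq] using hV s hs
  refine Real.le_sqrt_of_sq_le (le_trans ?_ h2)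
  have hn : MemLp (fun ω => ‖∑ s ∈ S, f s ω‖) 2 ρ := hF.norm
  -- Jensen's inequality for the square, in the form that the variance of the norm is nonnegative.
  have := variance_nonneg (fun ω => ‖∑ s ∈ S, f s ω‖) ρ
  rw [variance_eq_sub hn] at this
  simp only [Pi.pow_apply] at this
  linarith

/-- Sums of centred noise terms, each driven by its own sample: the `L¹` norm is controlled by the
square root of the sum of the variances, if the state `w s` at which sample `s` is used does not
depend on sample `s`, and of any two states one does not depend on the sample of the other. -/
theorem integral_norm_sum_noise_le [DecidableEq ι] {I : Ω → α} {ξ : ι → Ω → Ξ} (hI : Measurable I)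
    (hξ : ∀ s, Measurable (ξ s)) (hind : iIndepFun ξ ρ) (hIξ : IndepFun I (fun ω s => ξ s ω) ρ)
    {S : Finset ι} {b : ι → β × Ξ → E} {w : ι → α × (ι → Ξ) → β} {V : ι → ℝ}
    (hb : ∀ s, Measurable (b s)) (hw : ∀ s, Measurable (w s))
    (hself : ∀ s i x a, w s (i, Function.update x s a) = w s (i, x))
    (hpair : ∀ s ∈ S, ∀ t ∈ S, s ≠ t → (∀ i x a, w s (i, Function.update x t a) = w s (i, x)) ∨
      (∀ i x a, w t (i, Function.update x s a) = w t (i, x)))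
    (hint : ∀ s u, Integrable (fun x => b s (u, x)) (ρ.map (ξ s)))
    (hmean : ∀ s u, ∫ x, b s (u, x) ∂(ρ.map (ξ s)) = 0)
    (hint2 : ∀ s u, Integrable (fun x => ‖b s (u, x)‖ ^ 2) (ρ.map (ξ s)))
    (hV : ∀ s ∈ S, ∀ᵐ ω ∂ρ, ∫ x, ‖b s (w s (I ω, fun t => ξ t ω), x)‖ ^ 2 ∂(ρ.map (ξ s)) ≤ V s) :
    Integrable (fun ω => ∑ s ∈ S, b s (w s (I ω, fun t => ξ t ω), ξ s ω)) ρ ∧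
      ∫ ω, ‖∑ s ∈ S, b s (w s (I ω, fun t => ξ t ω), ξ s ω)‖ ∂ρ ≤ √(∑ s ∈ S, V s) := by
  -- The point `ω₀` only supplies some value `ξ s ω₀` at which a sample can be frozen.
  obtain ⟨ω₀⟩ : Nonempty Ω := nonempty_of_isProbabilityMeasure ρ
  have hW : ∀ s, Measurable fun ω => w s (I ω, fun t => ξ t ω) := fun s =>
    (hw s).comp (hI.prodMk (measurable_pi_iff.2 hξ))
  have hupd : ∀ s, IndepFun (fun ω => (I ω, Function.update (fun t => ξ t ω) s (ξ s ω₀)))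
    (ξ s) ρ := fun s => indepFun_init_update hI hξ hind hIξ s _
  have hupm : ∀ s, Measurable fun ω => (I ω, Function.update (fun t => ξ t ω) s (ξ s ω₀)) :=
    fun s => hI.prodMk (measurable_pi_iff.2 fun t => by
      by_cases hts : t = s
      · subst hts; simp only [Function.update_self]; exact measurable_const
      · simp only [Function.update_of_ne hts]; exact hξ t)
  have hWind : ∀ s, IndepFun (fun ω => w s (I ω, fun t => ξ t ω)) (ξ s) ρ := fun s => by
    have := (hupd s).comp (hw s) measurable_id
    simpa only [Function.comp_def, hself, id] using this
  have hnoise : ∀ s ∈ S, _ := fun s hs =>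
    memLp_two_noise (hW s) (hξ s) (hWind s) (hb s) (hint2 s) (hV s hs)
  -- Freezing sample `t` changes neither the state of `s` (by the invariance), nor that of `t` (by
  -- `hself`), nor `ξ s`. So the noise `s` and the state of `t` are functions of data independent of
  -- `ξ t`, over which the noise `t` has mean zero.
  have horth : ∀ s ∈ S, ∀ t ∈ S, s ≠ t →
      (∀ i x a, w s (i, Function.update x t a) = w s (i, x)) →
      ∫ ω, inner ℝ (b s (w s (I ω, fun t => ξ t ω), ξ s ω))
        (b t (w t (I ω, fun t => ξ t ω), ξ t ω)) ∂ρ = 0 := by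
    intro s hs t ht hst hinv
    have hA : Measurable fun q : α × (ι → Ξ) => b s (w s q, q.2 s) :=
      (hb s).comp ((hw s).prodMk ((measurable_pi_apply s).comp measurable_snd))
    have hB : Measurable fun q : (α × (ι → Ξ)) × Ξ => b t (w t q.1, q.2) :=
      (hb t).comp (((hw t).comp measurable_fst).prodMk measurable_snd)
    have := integral_inner_noise_eq_zero (hupm t) (hξ t) (hupd t) hA hB (fun u => hint t (w t u))
      (fun u => hmean t (w t u))
    simp only [hinv, hself, Function.update_of_ne hst] at this
    exact this (hnoise s hs).1 (hnoise t ht).1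
  refine ⟨(memLp_finsetSum S fun s hs => (hnoise s hs).1).integrable one_le_two,
    integral_norm_sum_orthogonal_le (fun s hs => (hnoise s hs).1) (fun s hs => (hnoise s hs).2)
      fun s hs t ht hst => ?_⟩
  rcases hpair s hs t ht hst with h | h
  · exact horth s hs t ht hst h
  · simp_rw [real_inner_comm (b t _)]
    exact horth t ht s hs hst.symm h

end Probability

/-! ### Measurability of the iterates in the initialization and the samples. -/

section Measurability

variable {M₁ M₂ K : ℕ} {Ξ γ : Type*} [MeasurableSpace Ξ] [MeasurableSpace γ]
  {prob : Problem M₁ M₂ K Ξ}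

theorem measurable_unit {E : Type*} [NormedAddCommGroup E] [NormedSpace ℝ E] [MeasurableSpace E]
    [BorelSpace E] [SecondCountableTopology E] {d : γ → E} (hd : Measurable d) :
    Measurable fun c => unit (d c) := hd.norm.inv.smul hd

theorem measurable_fst_pt {z : γ → Pt M₁ M₂} (hz : Measurable z) : Measurable fun c => (z c).fst :=
  (WithLp.continuous_fst 2 _ _).measurable.comp hz

theorem measurable_snd_pt {z : γ → Pt M₁ M₂} (hz : Measurable z) : Measurable fun c => (z c).snd :=
  (WithLp.continuous_snd 2 _ _).measurable.comp hz

theorem measurable_smul_pt (a : ℝ) {z : γ → Pt M₁ M₂} (hz : Measurable z) :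
    Measurable fun c => a • z c := hz.const_smul a

theorem measurable_gdaStep (a b : ℝ) {z d : γ → Pt M₁ M₂} (hz : Measurable z)
    (hd : Measurable d) : Measurable fun c => gdaStep a b (z c) (d c) :=
  continuous_pt.measurable.comp
    (((measurable_fst_pt hz).sub ((measurable_unit (measurable_fst_pt hd)).const_smul a)).prodMk
      ((measurable_snd_pt hz).add ((measurable_unit (measurable_snd_pt hd)).const_smul b)))

variable (p : Params) (N : ℕ)

theorem measurable_localIter (hp : prob.WellPosed) (k : Fin K) {z : γ → Pt M₁ M₂}
    {x : γ → ℕ → Ξ} (hz : Measurable z) (hx : ∀ n, Measurable fun c => x c n) (n : ℕ) :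
    Measurable fun c => localIter prob p k (z c) (x c) n := by
  induction n with
  | zero => exact hz
  | succ n ih => exact measurable_gdaStep _ _ ih ((hp.meas_grad k).comp (ih.prodMk (hx n)))

theorem measurable_hvp (hp : prob.WellPosed) (k : Fin K) {z w : γ → Pt M₁ M₂} {x : γ → Ξ}
    (hz : Measurable z) (hw : Measurable w) (hx : Measurable x) :
    Measurable fun c => hvp (prob.loss k (x c)) (z c) (w c) :=
  ContinuousLinearMap.measurable_apply₂.comp
    (((hp.meas_hess k).comp (hz.prodMk hx)).prodMk (hz.sub hw))

theorem measurable_nextMom (hp : prob.WellPosed) {s : γ → ServerState M₁ M₂}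
    {x : γ → Fin K → ℕ → Ξ} (hc : Measurable fun c => (s c).cur)
    (hv : Measurable fun c => (s c).prev) (hm : Measurable fun c => (s c).mom)
    (hx : ∀ k n, Measurable fun c => x c k n) :
    Measurable fun c => nextMom prob p N (s c) (x c) := by
  have h1 : Measurable fun c => ∑ k, localHvp prob N k (s c).cur (s c).prev (x c k) :=
    Finset.measurable_fun_sum _ fun k _ => Finset.measurable_fun_sum _ fun n _ =>
      measurable_smul_pt _ (measurable_hvp hp k hc hv (hx k n))
  have h2 : Measurable fun c => ∑ k, localGrad prob p N k (s c).cur (x c k) :=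
    Finset.measurable_fun_sum _ fun k _ => Finset.measurable_fun_sum _ fun n _ =>
      measurable_smul_pt _ ((hp.meas_grad k).comp
        ((measurable_localIter p hp k hc (hx k) n).prodMk (hx k n)))
  exact (measurable_smul_pt _ (hm.add (measurable_smul_pt _ h1))).add (measurable_smul_pt _ h2)

theorem measurable_serverState (hp : prob.WellPosed) {z₀ zm : γ → Pt M₁ M₂} {x₀ : γ → Fin K → Ξ}
    {x : γ → Fin K × ℕ × ℕ → Ξ} (hz₀ : Measurable z₀) (hzm : Measurable zm)
    (hx₀ : ∀ k, Measurable fun c => x₀ c k) (hx : ∀ s, Measurable fun c => x c s) (i : ℕ) :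
    (Measurable fun c => (serverState prob p N (z₀ c) (zm c) (x₀ c) (x c) i).cur) ∧
    (Measurable fun c => (serverState prob p N (z₀ c) (zm c) (x₀ c) (x c) i).prev) ∧
    (Measurable fun c => (serverState prob p N (z₀ c) (zm c) (x₀ c) (x c) i).mom) := by
  induction i with
  | zero =>
    have h : Measurable fun c => ∑ k, grad (prob.loss k (x₀ c k)) (zm c) :=
      Finset.measurable_fun_sum _ fun k _ => (hp.meas_grad k).comp (hzm.prodMk (hx₀ k))
    exact ⟨hz₀, hzm, measurable_smul_pt _ h⟩
  | succ i ih =>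
    obtain ⟨h1, h2, h3⟩ := ih
    have hm := measurable_nextMom p N hp h1 h2 h3 (x := fun c k n => x c (k, i, n))
      fun k n => hx _
    exact ⟨measurable_gdaStep _ _ h1 hm, h1, hm⟩

end Measurability

/-! ### Which samples an iterate depends on. -/

section Dependence

variable {M₁ M₂ K : ℕ} {Ξ : Type*} [MeasurableSpace Ξ] (prob : Problem M₁ M₂ K Ξ) (p : Params)
  (N : ℕ)

theorem localIter_congr (k : Fin K) (z : Pt M₁ M₂) {x x' : ℕ → Ξ} {n : ℕ}
    (h : ∀ m < n, x m = x' m) : localIter prob p k z x n = localIter prob p k z x' n := by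
  induction n with
  | zero => rfl
  | succ n ih =>
    simp only [localIter]
    rw [ih fun m hm => h m (by omega), h n (by omega)]

theorem serverState_congr (z₀ zm : Pt M₁ M₂) (x₀ : Fin K → Ξ) {x x' : Fin K × ℕ × ℕ → Ξ} {i : ℕ}
    (h : ∀ k j n, j < i → x (k, j, n) = x' (k, j, n)) :
    serverState prob p N z₀ zm x₀ x i = serverState prob p N z₀ zm x₀ x' i := by
  induction i with
  | zero => rfl
  | succ i ih =>
    simp only [serverState]
    rw [ih fun k j n hj => h k j n (by omega)]
    congr 1
    funext k n
    exact h k i n (by omega)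

/-- State `i` is what the server holds before round `i`, so samples of round `i` itself are already
irrelevant; hence `≤` and not `<`. -/
theorem serverState_update (z₀ zm : Pt M₁ M₂) (x₀ : Fin K → Ξ) (x : Fin K × ℕ × ℕ → Ξ) (a : Ξ)
    {i : ℕ} {t : Fin K × ℕ × ℕ} (h : i ≤ t.2.1) :
    serverState prob p N z₀ zm x₀ (Function.update x t a) i
      = serverState prob p N z₀ zm x₀ x i := by
  refine serverState_congr prob p N z₀ zm x₀ fun k j n hj => Function.update_of_ne ?_ _ _
  rintro rfl
  simp only at h
  omega

/-- The local iterate `z_{k,i,n}` does not depend on samples of later rounds, of other agents in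
the same round, or of the same or later local steps. -/
theorem localIter_serverState_update (z₀ zm : Pt M₁ M₂) (x₀ : Fin K → Ξ)
    (x : Fin K × ℕ × ℕ → Ξ) (a : Ξ) {s t : Fin K × ℕ × ℕ} (h : s.2.1 ≤ t.2.1)
    (h' : s.2.1 = t.2.1 → s.1 = t.1 → s.2.2 ≤ t.2.2) :
    localIter prob p s.1 (serverState prob p N z₀ zm x₀ (Function.update x t a) s.2.1).cur
        (fun m => Function.update x t a (s.1, s.2.1, m)) s.2.2
      = localIter prob p s.1 (serverState prob p N z₀ zm x₀ x s.2.1).cur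
        (fun m => x (s.1, s.2.1, m)) s.2.2 := by
  rw [serverState_update prob p N z₀ zm x₀ x a h]
  refine localIter_congr prob p _ _ fun m hm => Function.update_of_ne ?_ _ _
  rintro rfl
  have := h' rfl rfl
  simp only at this
  omega

end Dependence

/-! ### The recursion for the momentum error and its deterministic terms. -/

section Momentum

variable {M₁ M₂ K : ℕ} {Ξ : Type*} [MeasurableSpace Ξ] {prob : Problem M₁ M₂ K Ξ}
  {Lf Lh σ σh ν : ℝ} {p : Params} {N : ℕ}

theorem norm_gdaStep_sub_le {a b : ℝ} (ha : 0 ≤ a) (hb : 0 ≤ b) (z d : Pt M₁ M₂) :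
    ‖(gdaStep a b z d).fst - z.fst‖ ≤ a ∧ ‖(gdaStep a b z d).snd - z.snd‖ ≤ b := by
  constructor
  · simp only [gdaStep, pt_fst, sub_sub_cancel_left, norm_neg]
    rw [norm_smul, Real.norm_of_nonneg ha]
    exact mul_le_of_le_one_right ha (norm_unit_le _)
  · simp only [gdaStep, pt_snd, add_sub_cancel_left]
    rw [norm_smul, Real.norm_of_nonneg hb]
    exact mul_le_of_le_one_right hb (norm_unit_le _)

/-- Normalization bounds the length of every local step regardless of the size of the local
gradient, which is what makes a dissimilarity assumption unnecessary. -/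
theorem norm_localIter_sub_le (hx : 0 ≤ p.locμx) (hy : 0 ≤ p.locμy) (k : Fin K) (z : Pt M₁ M₂)
    (x : ℕ → Ξ) (n : ℕ) :
    ‖localIter prob p k z x n - z‖ ≤ n * (p.locμx + p.locμy) := by
  induction n with
  | zero => simp [localIter]
  | succ n ih =>
    simp only [localIter]
    set w := localIter prob p k z x n
    have h := norm_gdaStep_sub_le hx hy w (grad (prob.loss k (x n)) w)
    have h1 := norm_sub_le_norm_sub_add_norm_sub (gdaStep p.locμx p.locμy w
      (grad (prob.loss k (x n)) w)) w z
    have h2 := norm_sub_pt_le (z := gdaStep p.locμx p.locμy w (grad (prob.loss k (x n)) w)) (w := w)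
    push_cast
    linarith [h.1, h.2]

/-- The average over the agents and the local steps `n < N`. -/
def avg (N : ℕ) (v : Fin K → ℕ → Pt M₁ M₂) : Pt M₁ M₂ :=
  (1 / (K : ℝ)) • ∑ k, ∑ n ∈ Finset.range N, (1 / (N : ℝ)) • v k n

theorem norm_avg_le (hK : 0 < K) (hN : 0 < N) {v : Fin K → ℕ → Pt M₁ M₂} {C : ℝ}
    (h : ∀ k, ∀ n < N, ‖v k n‖ ≤ C) : ‖avg N v‖ ≤ C := by
  have hN' : (0 : ℝ) < N := by exact_mod_cast hN
  refine norm_average_le hK fun k => ?_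
  have h1 := norm_sum_le_of_le (Finset.range N) (f := fun n => (1 / (N : ℝ)) • v k n)
    (n := fun _ => 1 / (N : ℝ) * C) (fun n hn => by
      rw [norm_smul, Real.norm_of_nonneg (by positivity)]
      gcongr
      exact h k n (Finset.mem_range.1 hn))
  refine h1.trans_eq ?_
  rw [Finset.sum_const, Finset.card_range, nsmul_eq_mul]
  field_simp

theorem avg_add (v w : Fin K → ℕ → Pt M₁ M₂) :
    avg N (fun k n => v k n + w k n) = avg N v + avg N w := by
  simp only [avg, smul_add, Finset.sum_add_distrib]

theorem avg_const (hN : 0 < N) (v : Fin K → Pt M₁ M₂) :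
    avg N (fun k _ => v k) = (1 / (K : ℝ)) • ∑ k, v k := by
  have hN' : (N : ℝ) ≠ 0 := by positivity
  simp only [avg, Finset.sum_const, Finset.card_range, ← Nat.cast_smul_eq_nsmul ℝ, smul_smul]
  congr 2
  funext k
  rw [mul_one_div_cancel hN', one_smul]

/-- The linearization error of the exact gradient between two server iterates. -/
def linErr (prob : Problem M₁ M₂ K Ξ) (z w : Pt M₁ M₂) : Pt M₁ M₂ :=
  (1 / (K : ℝ)) • ∑ k, (grad (prob.localCost k) w - grad (prob.localCost k) z
    + hess (prob.localCost k) z (z - w))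

/-- The Hessian noise of agent `k` for the sample `x`. -/
def hessNoise (prob : Problem M₁ M₂ K Ξ) (k : Fin K) (q : (Pt M₁ M₂ × Pt M₁ M₂) × Ξ) :
    Pt M₁ M₂ :=
  (hess (prob.loss k q.2) q.1.1 - hess (prob.localCost k) q.1.1) (q.1.1 - q.1.2)

/-- The gradient noise of agent `k` for the sample `x`. -/
def gradNoise (prob : Problem M₁ M₂ K Ξ) (k : Fin K) (q : Pt M₁ M₂ × Ξ) : Pt M₁ M₂ :=
  grad (prob.loss k q.2) q.1 - grad (prob.localCost k) q.1

/-- The drift of the local iterates within a round. -/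
def drift (prob : Problem M₁ M₂ K Ξ) (p : Params) (N : ℕ) (z : Pt M₁ M₂) (x : Fin K → ℕ → Ξ) :
    Pt M₁ M₂ :=
  avg N fun k n => grad (prob.localCost k) (localIter prob p k z (x k) n)
    - grad (prob.localCost k) z

/-- The exact Hessian-vector product equals `∇J(cur) - ∇J(prev)` plus `linErr`. Added to the old
momentum, it replaces the stale target `∇J(prev)` by `∇J(cur)`, and everything else is drift or
centred noise. -/
theorem nextMom_sub_grad (hd : ∀ k, Differentiable ℝ (prob.localCost k)) (hN : 0 < N)
    (hγ : p.γ = 1) (s : ServerState M₁ M₂) (x : Fin K → ℕ → Ξ) :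
    nextMom prob p N s x - grad prob.cost s.cur
      = (1 - p.β) • (s.mom - grad prob.cost s.prev)
        + ((1 - p.β) • linErr prob s.cur s.prev + p.β • drift prob p N s.cur x
        + (1 - p.β) • avg N (fun k n => hessNoise prob k ((s.cur, s.prev), x k n))
        + p.β • avg N (fun k n => gradNoise prob k
            (localIter prob p k s.cur (x k) n, x k n))) := by
  have e1 : (p.γ / (K : ℝ)) • ∑ k, localHvp prob N k s.cur s.prev (x k)
      = avg N (fun k n => hessNoise prob k ((s.cur, s.prev), x k n))
        + (linErr prob s.cur s.prev - grad prob.cost s.prev + grad prob.cost s.cur) := by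
    have : linErr prob s.cur s.prev - grad prob.cost s.prev + grad prob.cost s.cur
        = avg N (fun k _ => hess (prob.localCost k) s.cur (s.cur - s.prev)) := by
      rw [avg_const hN, linErr, grad_cost hd, grad_cost hd, ← smul_sub, ← smul_add,
        ← Finset.sum_sub_distrib, ← Finset.sum_add_distrib]
      congr 2
      funext k
      abel
    rw [this, ← avg_add, hγ]
    simp only [avg, localHvp, hvp, hessNoise, sub_apply, sub_add_cancel]
  have e2 : (p.β / (K : ℝ)) • ∑ k, localGrad prob p N k s.cur (x k)
      = p.β • (avg N (fun k n => gradNoise prob k (localIter prob p k s.cur (x k) n, x k n))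
        + drift prob p N s.cur x + grad prob.cost s.cur) := by
    have : grad prob.cost s.cur = avg N (fun k _ => grad (prob.localCost k) s.cur) := by
      rw [avg_const hN, grad_cost hd]
    rw [this, drift, ← avg_add, ← avg_add]
    simp only [avg, localGrad, gradNoise, smul_smul, mul_one_div, sub_add_sub_cancel,
      sub_add_cancel]
  rw [nextMom, e1, e2]
  module

theorem differentiable_grad {f : Pt M₁ M₂ → ℝ} (hf : ContDiff ℝ 2 f) :
    Differentiable ℝ (grad f) := by
  have h1 : Differentiable ℝ (fderiv ℝ f) :=
    (hf.fderiv_right (m := 1) (by norm_num)).differentiable (by norm_num)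
  exact ((InnerProductSpace.toDual ℝ (Pt M₁ M₂)).symm.toContinuousLinearEquiv
    |>.differentiable).comp h1

/-- Each summand is the first-order Taylor remainder of the gradient of `J_k`, expanded at `z` and
evaluated at `w`. -/
theorem norm_linErr_le (h : prob.Assumptions Lf Lh σ σh ν) (hK : 0 < K) (z w : Pt M₁ M₂) :
    ‖linErr prob z w‖ ≤ Lh * ‖z - w‖ ^ 2 := by
  refine norm_average_le hK fun k => ?_
  have := norm_taylor_le (z := z) (w := w)
    (differentiable_grad (h.lipschitz.contDiff k)) h.Lh_nonneg
    (fun v => h.lipschitz.hess_lipschitz k v z)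
  rw [norm_sub_rev z w]
  rwa [← neg_sub z w, map_neg, sub_neg_eq_add, neg_sub] at this

theorem norm_drift_le (h : prob.Assumptions Lf Lh σ σh ν) (hK : 0 < K) (hN : 0 < N)
    (hx : 0 ≤ p.locμx) (hy : 0 ≤ p.locμy) (z : Pt M₁ M₂) (x : Fin K → ℕ → Ξ) :
    ‖drift prob p N z x‖ ≤ N * Lf * (p.locμx + p.locμy) := by
  refine norm_avg_le hK hN fun k n hn => (h.lipschitz.smooth k _ _).trans ?_
  have h1 := norm_localIter_sub_le (prob := prob) hx hy k z (x k) n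
  have h2 : (n : ℝ) ≤ N := by exact_mod_cast hn.le
  have hL := h.Lf_pos
  calc Lf * ‖localIter prob p k z (x k) n - z‖ ≤ Lf * (n * (p.locμx + p.locμy)) := by gcongr
    _ ≤ Lf * (N * (p.locμx + p.locμy)) := by gcongr
    _ = _ := by ring

theorem eq_pow_smul_add_sum {E : Type*} [AddCommGroup E] [Module ℝ E] {q : ℝ} {e u : ℕ → E}
    (h : ∀ i, e (i + 1) = q • e i + u i) (i : ℕ) :
    e i = q ^ i • e 0 + ∑ j ∈ Finset.range i, q ^ (i - 1 - j) • u j := by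
  induction i with
  | zero => simp
  | succ i ih =>
    rw [h, ih, Finset.sum_range_succ, smul_add, smul_smul, ← pow_succ', Finset.smul_sum, add_assoc]
    congr 1
    simp only [add_tsub_cancel_right, Nat.sub_self, pow_zero, one_smul]
    congr 1
    refine Finset.sum_congr rfl fun j hj => ?_
    have := Finset.mem_range.1 hj
    rw [smul_smul, ← pow_succ']
    congr 2
    omega

/-- An inequality on `q` allows both `q = 1 - β`, for the bias terms, and `q = (1 - β)²`, for the
variances. -/
theorem sum_pow_sub_le {q β : ℝ} (hq : 0 ≤ q) (hq1 : q ≤ 1 - β) (hβ : 0 < β) (i : ℕ) :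
    ∑ j ∈ Finset.range (i + 1), q ^ (i - j) ≤ 1 / β := by
  have h1 := Finset.sum_range_reflect (fun j => q ^ j) (i + 1)
  simp only [add_tsub_cancel_right] at h1
  rw [h1]
  have h2 := geom_sum_mul_neg q (i + 1)
  have h3 : 0 ≤ q ^ (i + 1) := by positivity
  rw [le_div_iff₀ hβ]
  have h4 : 0 ≤ ∑ j ∈ Finset.range (i + 1), q ^ j := Finset.sum_nonneg fun _ _ => by positivity
  nlinarith

end Momentum

/-! ### Mean and variance of the gradient and Hessian noise. -/

section Noise

variable {M₁ M₂ K : ℕ} {Ξ : Type*} [MeasurableSpace Ξ] {prob : Problem M₁ M₂ K Ξ}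
  {Lf Lh σ σh ν : ℝ} {p : Params} {N : ℕ}

theorem continuous_grad_localCost (h : prob.Assumptions Lf Lh σ σh ν) (k : Fin K) :
    Continuous (grad (prob.localCost k)) :=
  (differentiable_grad (h.lipschitz.contDiff k)).continuous

theorem measurable_gradNoise (h : prob.Assumptions Lf Lh σ σh ν) (k : Fin K) :
    Measurable (gradNoise prob k) :=
  (h.wellPosed.meas_grad k).sub ((continuous_grad_localCost h k).measurable.comp measurable_fst)

theorem measurable_hessNoise (h : prob.Assumptions Lf Lh σ σh ν) (k : Fin K) :
    Measurable (hessNoise prob k) := by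
  have h0 : Measurable (hess (prob.localCost k)) := measurable_fderiv ℝ (grad (prob.localCost k))
  have h1 : Measurable fun q : (Pt M₁ M₂ × Pt M₁ M₂) × Ξ => q.1.1 :=
    measurable_fst.comp measurable_fst
  have h2 : Measurable fun q : (Pt M₁ M₂ × Pt M₁ M₂) × Ξ => q.1.2 :=
    measurable_snd.comp measurable_fst
  have h3 : Measurable fun q : (Pt M₁ M₂ × Pt M₁ M₂) × Ξ => hess (prob.loss k q.2) q.1.1 :=
    (h.wellPosed.meas_hess k).comp (h1.prodMk measurable_snd)
  exact ContinuousLinearMap.measurable_apply₂.comp ((h3.sub (h0.comp h1)).prodMk (h1.sub h2))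

theorem integrable_sub_const {E : Type*} [NormedAddCommGroup E] {μ : Measure Ξ}
    [IsFiniteMeasure μ] {f : Ξ → E} (hf : Integrable f μ) (c : E) :
    Integrable (fun x => f x - c) μ := hf.sub (integrable_const c)

theorem integrable_gradNoise (h : prob.Assumptions Lf Lh σ σh ν) (k : Fin K) (z : Pt M₁ M₂) :
    Integrable (fun x => gradNoise prob k (z, x)) (prob.law k) := by
  have := h.wellPosed.prob_law k
  simp only [gradNoise]
  exact integrable_sub_const (h.variance.integrable_grad k z) (grad (prob.localCost k) z)

theorem integral_gradNoise (h : prob.Assumptions Lf Lh σ σh ν) (k : Fin K) (z : Pt M₁ M₂) :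
    ∫ x, gradNoise prob k (z, x) ∂(prob.law k) = 0 := by
  have := h.wellPosed.prob_law k
  simp only [gradNoise]
  rw [integral_sub (h.variance.integrable_grad k z) (integrable_const _),
    h.variance.unbiased_grad, integral_const, probReal_univ, one_smul, sub_self]

theorem integrable_hess_sub (h : prob.Assumptions Lf Lh σ σh ν) (k : Fin K) (z : Pt M₁ M₂) :
    Integrable (fun x => hess (prob.loss k x) z - hess (prob.localCost k) z) (prob.law k) := by
  have := h.wellPosed.prob_law k
  exact integrable_sub_const (h.variance.integrable_hess k z) _

theorem integrable_hessNoise (h : prob.Assumptions Lf Lh σ σh ν) (k : Fin K)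
    (u : Pt M₁ M₂ × Pt M₁ M₂) : Integrable (fun x => hessNoise prob k (u, x)) (prob.law k) := by
  simp only [hessNoise]
  exact (integrable_hess_sub h k u.1).apply_continuousLinearMap (u.1 - u.2)

theorem integral_hessNoise (h : prob.Assumptions Lf Lh σ σh ν) (k : Fin K)
    (u : Pt M₁ M₂ × Pt M₁ M₂) : ∫ x, hessNoise prob k (u, x) ∂(prob.law k) = 0 := by
  have := h.wellPosed.prob_law k
  simp only [hessNoise]
  rw [← ContinuousLinearMap.integral_apply (integrable_hess_sub h k u.1),
    integral_sub (h.variance.integrable_hess k u.1) (integrable_const _),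
    h.variance.unbiased_hess, integral_const, probReal_univ, one_smul, sub_self,
    zero_apply]

theorem norm_hessNoise_sq_le (k : Fin K) (u : Pt M₁ M₂ × Pt M₁ M₂) (x : Ξ) :
    ‖hessNoise prob k (u, x)‖ ^ 2
      ≤ ‖hess (prob.loss k x) u.1 - hess (prob.localCost k) u.1‖ ^ 2 * ‖u.1 - u.2‖ ^ 2 := by
  rw [← mul_pow]
  gcongr
  exact ContinuousLinearMap.le_opNorm _ _

theorem integrable_sq_hessNoise (h : prob.Assumptions Lf Lh σ σh ν) (k : Fin K)
    (u : Pt M₁ M₂ × Pt M₁ M₂) :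
    Integrable (fun x => ‖hessNoise prob k (u, x)‖ ^ 2) (prob.law k) := by
  refine ((h.variance.integrable_sq_hess k u.1).mul_const (‖u.1 - u.2‖ ^ 2)).mono'
    ((measurable_hessNoise h k).comp measurable_prodMk_left |>.norm.pow_const 2
      |>.aestronglyMeasurable) (.of_forall fun x => ?_)
  rw [Real.norm_of_nonneg (by positivity)]
  exact norm_hessNoise_sq_le k u x

theorem integral_sq_hessNoise_le (h : prob.Assumptions Lf Lh σ σh ν) (k : Fin K)
    (u : Pt M₁ M₂ × Pt M₁ M₂) :
    ∫ x, ‖hessNoise prob k (u, x)‖ ^ 2 ∂(prob.law k) ≤ σh ^ 2 * ‖u.1 - u.2‖ ^ 2 := by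
  refine (integral_mono (integrable_sq_hessNoise h k u)
    ((h.variance.integrable_sq_hess k u.1).mul_const _)
    fun x => norm_hessNoise_sq_le k u x).trans ?_
  rw [integral_mul_const]
  gcongr
  exact h.variance.variance_hess k u.1

end Noise

/-! ### Weighted sums of noise along a run. -/

section MomentumError

variable {M₁ M₂ K : ℕ} {Ξ Ω : Type*} [MeasurableSpace Ξ] [MeasurableSpace Ω]
  {prob : Problem M₁ M₂ K Ξ} {Lf Lh σ σh ν : ℝ} {p : Params} {N : ℕ} {ρ : Measure Ω}
  {R : RunData M₁ M₂ K Ξ Ω}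

/-- The initialization `(z₀, z_{-1}, (ξ_{k,-1})_k)`. -/
def RunData.start (R : RunData M₁ M₂ K Ξ Ω) (ω : Ω) : Pt M₁ M₂ × Pt M₁ M₂ × (Fin K → Ξ) :=
  (R.z₀ ω, R.zm ω, fun k => R.ξinit k ω)

/-- The server state as a function of the initialization and the samples. -/
def stateFn (prob : Problem M₁ M₂ K Ξ) (p : Params) (N i : ℕ)
    (q : (Pt M₁ M₂ × Pt M₁ M₂ × (Fin K → Ξ)) × (Fin K × ℕ × ℕ → Ξ)) : ServerState M₁ M₂ :=
  serverState prob p N q.1.1 q.1.2.1 q.1.2.2 q.2 i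

/-- The server state of a run. -/
def RunData.state (R : RunData M₁ M₂ K Ξ Ω) (prob : Problem M₁ M₂ K Ξ) (p : Params) (N i : ℕ)
    (ω : Ω) : ServerState M₁ M₂ :=
  stateFn prob p N i (R.start ω, fun s => R.ξ s ω)

theorem RunData.Valid.measurable_start (hR : R.Valid prob p ρ) : Measurable R.start :=
  hR.meas_z₀.prodMk (hR.meas_zm.prodMk (measurable_pi_iff.2 hR.meas_ξinit))

theorem measurable_stateFn (hp : prob.WellPosed) (i : ℕ) :
    Measurable (fun q => (stateFn prob p N i q).cur) ∧
    Measurable (fun q => (stateFn prob p N i q).prev) ∧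
    Measurable (fun q => (stateFn prob p N i q).mom) :=
  measurable_serverState p N hp (measurable_fst.comp measurable_fst)
    (measurable_fst.comp (measurable_snd.comp measurable_fst))
    (fun k => (measurable_pi_apply k).comp
      (measurable_snd.comp (measurable_snd.comp measurable_fst)))
    (fun s => (measurable_pi_apply s).comp measurable_snd) i

theorem RunData.Valid.measurable_state (hp : prob.WellPosed) (hR : R.Valid prob p ρ) (i : ℕ) :
    Measurable (fun ω => (R.state prob p N i ω).cur) ∧
    Measurable (fun ω => (R.state prob p N i ω).prev) ∧
    Measurable (fun ω => (R.state prob p N i ω).mom) := by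
  have h : Measurable fun ω => (R.start ω, fun s => R.ξ s ω) :=
    hR.measurable_start.prodMk (measurable_pi_iff.2 hR.meas_ξ)
  obtain ⟨h1, h2, h3⟩ := measurable_stateFn (p := p) (N := N) hp i
  exact ⟨h1.comp h, h2.comp h, h3.comp h⟩

/-- The local iterate `z_{k,i,n}`, `s = (k, i, n)`. -/
def localFn (prob : Problem M₁ M₂ K Ξ) (p : Params) (N : ℕ) (s : Fin K × ℕ × ℕ)
    (q : (Pt M₁ M₂ × Pt M₁ M₂ × (Fin K → Ξ)) × (Fin K × ℕ × ℕ → Ξ)) : Pt M₁ M₂ :=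
  localIter prob p s.1 (stateFn prob p N s.2.1 q).cur (fun m => q.2 (s.1, s.2.1, m)) s.2.2

theorem norm_smul_sq {E : Type*} [NormedAddCommGroup E] [NormedSpace ℝ E] (c : ℝ) (v : E) :
    ‖c • v‖ ^ 2 = c ^ 2 * ‖v‖ ^ 2 := by
  rw [norm_smul, mul_pow, Real.norm_eq_abs, sq_abs]

/-- The orthogonality lemma indexed by agents, with the single state `z_{-1}` that is independent of
the initial samples. -/
theorem init_noise_le [IsProbabilityMeasure ρ] (h : prob.Assumptions Lf Lh σ σh ν)
    (hR : R.Valid prob p ρ) (hK : 0 < K) :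
    Integrable (fun ω => initMom prob (R.zm ω) (fun k => R.ξinit k ω)
      - grad prob.cost (R.zm ω)) ρ ∧
    ∫ ω, ‖initMom prob (R.zm ω) (fun k => R.ξinit k ω) - grad prob.cost (R.zm ω)‖ ∂ρ
      ≤ σ / √(K : ℝ) := by
  have hK' : (0 : ℝ) < K := by exact_mod_cast hK
  have key := integral_norm_sum_noise_le (S := Finset.univ) hR.meas_zm hR.meas_ξinit
    hR.indep_ξinit hR.indep_zm
    (b := fun k q => (1 / (K : ℝ)) • gradNoise prob k q) (w := fun _ q => q.1)
    (V := fun _ => (1 / (K : ℝ)) ^ 2 * σ ^ 2)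
    (fun k => measurable_smul_pt _ (measurable_gradNoise h k)) (fun _ => measurable_fst)
    (fun _ _ _ _ => rfl) (fun _ _ _ _ _ => Or.inl fun _ _ _ => rfl)
    (fun k u => by rw [hR.law_ξinit]; exact (integrable_gradNoise h k u).smul (1 / (K : ℝ)))
    (fun k u => by rw [hR.law_ξinit, integral_smul, integral_gradNoise h, smul_zero])
    (fun k u => by
      simp only [norm_smul_sq]
      rw [hR.law_ξinit]
      exact (h.variance.integrable_sq_grad k u).const_mul _)
    (fun k _ => .of_forall fun ω => by
      simp only [norm_smul_sq]
      rw [hR.law_ξinit, integral_const_mul]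
      gcongr
      exact h.variance.variance_grad k _)
  have e : ∀ ω, ∑ k, (1 / (K : ℝ)) • gradNoise prob k (R.zm ω, R.ξinit k ω)
      = initMom prob (R.zm ω) (fun k => R.ξinit k ω) - grad prob.cost (R.zm ω) := fun ω => by
    rw [initMom, grad_cost h.differentiable_localCost, ← smul_sub, ← Finset.sum_sub_distrib,
      Finset.smul_sum]
    rfl
  simp only [e] at key
  refine ⟨key.1, key.2.trans_eq ?_⟩
  rw [Finset.sum_const, Finset.card_univ, Fintype.card_fin, nsmul_eq_mul]
  have : (K : ℝ) * ((1 / (K : ℝ)) ^ 2 * σ ^ 2) = σ ^ 2 / K := by field_simp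
  rw [this, Real.sqrt_div (sq_nonneg σ), Real.sqrt_sq h.σ_nonneg]

/-- A local iterate sees only samples of earlier rounds and earlier samples of its own agent in the
same round. Orthogonality therefore holds jointly over agents, rounds and local steps, with
arbitrary weights `c`. -/
theorem grad_noise_le [IsProbabilityMeasure ρ] (h : prob.Assumptions Lf Lh σ σh ν)
    (hR : R.Valid prob p ρ)
    (S : Finset (Fin K × ℕ × ℕ)) (c : Fin K × ℕ × ℕ → ℝ) :
    Integrable (fun ω => ∑ s ∈ S, c s • gradNoise prob s.1
      (localFn prob p N s (R.start ω, fun s => R.ξ s ω), R.ξ s ω)) ρ ∧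
    ∫ ω, ‖∑ s ∈ S, c s • gradNoise prob s.1
      (localFn prob p N s (R.start ω, fun s => R.ξ s ω), R.ξ s ω)‖ ∂ρ
      ≤ √(∑ s ∈ S, c s ^ 2 * σ ^ 2) := by
  refine integral_norm_sum_noise_le hR.measurable_start hR.meas_ξ
    hR.indep_ξ hR.indep_init
    (b := fun s q => c s • gradNoise prob s.1 q) (w := fun s q => localFn prob p N s q)
    (V := fun s => c s ^ 2 * σ ^ 2)
    (fun s => measurable_smul_pt _ (measurable_gradNoise h s.1))
    (fun s => measurable_localIter p h.wellPosed s.1 (measurable_stateFn h.wellPosed s.2.1).1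
      (fun n => (measurable_pi_apply _).comp measurable_snd) s.2.2)
    (fun s i x a => localIter_serverState_update prob p N _ _ _ x a le_rfl fun _ _ => le_rfl)
    (fun s _ t _ hst => ?_)
    (fun s u => by rw [hR.law_ξ]; exact (integrable_gradNoise h s.1 u).smul (c s))
    (fun s u => by rw [hR.law_ξ, integral_smul, integral_gradNoise h, smul_zero])
    (fun s u => by
      simp only [norm_smul_sq]
      rw [hR.law_ξ]
      exact (h.variance.integrable_sq_grad s.1 u).const_mul _)
    (fun s _ => .of_forall fun ω => by
      simp only [norm_smul_sq]
      rw [hR.law_ξ, integral_const_mul]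
      gcongr
      exact h.variance.variance_grad s.1 _)
  -- Either `t` comes too late to influence the iterate of `s`, or `s` comes too late to influence
  -- that of `t`.
  by_cases hc : s.2.1 ≤ t.2.1 ∧ (s.2.1 = t.2.1 → s.1 = t.1 → s.2.2 ≤ t.2.2)
  · exact Or.inl fun i x a => localIter_serverState_update prob p N _ _ _ x a hc.1 hc.2
  · refine Or.inr fun i x a => localIter_serverState_update prob p N _ _ _ x a ?_ ?_
    · by_contra h1
      exact hc ⟨by omega, fun _ _ => by omega⟩
    · intro h1 h2
      by_contra h3
      exact hc ⟨h1.symm.le, fun _ _ => by omega⟩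

/-- From `i = 1` on the bound comes from the normalized update and holds surely; only `i = 0` needs
the almost sure assumption on the initial points. -/
theorem norm_cur_sub_prev_sq_le (hR : R.Valid prob p ρ) (hx : 0 ≤ p.μx) (hy : 0 ≤ p.μy) :
    ∀ᵐ ω ∂ρ, ∀ i, ‖(R.state prob p N i ω).cur - (R.state prob p N i ω).prev‖ ^ 2
      ≤ p.μx ^ 2 + p.μy ^ 2 := by
  filter_upwards [hR.init_x, hR.init_y] with ω h1 h2 i
  rw [norm_sq_pt, WithLp.sub_fst, WithLp.sub_snd]
  cases i with
  | zero =>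
    have h1' : ‖(R.state prob p N 0 ω).cur.fst - (R.state prob p N 0 ω).prev.fst‖ ≤ p.μx := h1
    have h2' : ‖(R.state prob p N 0 ω).cur.snd - (R.state prob p N 0 ω).prev.snd‖ ≤ p.μy := h2
    gcongr
  | succ i =>
    have h3 := norm_gdaStep_sub_le hx hy (R.state prob p N i ω).cur
      (R.state prob p N (i + 1) ω).mom
    have h1' : ‖(R.state prob p N (i + 1) ω).cur.fst - (R.state prob p N (i + 1) ω).prev.fst‖
      ≤ p.μx := h3.1
    have h2' : ‖(R.state prob p N (i + 1) ω).cur.snd - (R.state prob p N (i + 1) ω).prev.snd‖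
      ≤ p.μy := h3.2
    gcongr

/-- Hessians are evaluated at server iterates that are fixed before the round starts, so comparing
round indices is enough. The displacement bound converts the operator variance into a vector
variance. -/
theorem hess_noise_le [IsProbabilityMeasure ρ] (h : prob.Assumptions Lf Lh σ σh ν)
    (hR : R.Valid prob p ρ)
    (hx : 0 ≤ p.μx) (hy : 0 ≤ p.μy) (S : Finset (Fin K × ℕ × ℕ)) (c : Fin K × ℕ × ℕ → ℝ) :
    Integrable (fun ω => ∑ s ∈ S, c s • hessNoise prob s.1
      (((R.state prob p N s.2.1 ω).cur, (R.state prob p N s.2.1 ω).prev), R.ξ s ω)) ρ ∧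
    ∫ ω, ‖∑ s ∈ S, c s • hessNoise prob s.1
      (((R.state prob p N s.2.1 ω).cur, (R.state prob p N s.2.1 ω).prev), R.ξ s ω)‖ ∂ρ
      ≤ √(∑ s ∈ S, c s ^ 2 * (σh ^ 2 * (p.μx ^ 2 + p.μy ^ 2))) := by
  refine integral_norm_sum_noise_le hR.measurable_start hR.meas_ξ
    hR.indep_ξ hR.indep_init
    (b := fun s q => c s • hessNoise prob s.1 q)
    (w := fun s q => ((stateFn prob p N s.2.1 q).cur, (stateFn prob p N s.2.1 q).prev))
    (V := fun s => c s ^ 2 * (σh ^ 2 * (p.μx ^ 2 + p.μy ^ 2)))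
    (fun s => measurable_smul_pt _ (measurable_hessNoise h s.1))
    (fun s => (measurable_stateFn h.wellPosed s.2.1).1.prodMk
      (measurable_stateFn h.wellPosed s.2.1).2.1)
    (fun s i x a => ?_)
    (fun s _ t _ hst => ?_)
    (fun s u => by rw [hR.law_ξ]; exact (integrable_hessNoise h s.1 u).smul (c s))
    (fun s u => by rw [hR.law_ξ, integral_smul, integral_hessNoise h, smul_zero])
    (fun s u => by
      simp only [norm_smul_sq]
      rw [hR.law_ξ]
      exact (integrable_sq_hessNoise h s.1 u).const_mul _)
    (fun s _ => ?_)
  · simp only [stateFn]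
    rw [serverState_update prob p N _ _ _ x a le_rfl]
  · rcases le_total s.2.1 t.2.1 with hle | hle
    · left
      intro i x a
      simp only [stateFn]
      rw [serverState_update prob p N _ _ _ x a hle]
    · right
      intro i x a
      simp only [stateFn]
      rw [serverState_update prob p N _ _ _ x a hle]
  · filter_upwards [norm_cur_sub_prev_sq_le (N := N) hR hx hy] with ω hω
    simp only [norm_smul_sq]
    rw [hR.law_ξ, integral_const_mul]
    gcongr
    refine (integral_sq_hessNoise_le h s.1 _).trans ?_
    gcongr
    exact hω s.2.1

end MomentumError

/-! ### The expected momentum error and the explicit bound. -/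

section MomentumErrorBound

variable {M₁ M₂ K : ℕ} {Ξ Ω : Type*} [MeasurableSpace Ξ] [MeasurableSpace Ω]
  {prob : Problem M₁ M₂ K Ξ} {Lf Lh σ σh ν : ℝ} {p : Params} {N : ℕ} {ρ : Measure Ω}
  {R : RunData M₁ M₂ K Ξ Ω}

/-- The indices `(k, j, n)` of the samples of the rounds `j ≤ i`. -/
def roundIdx (K N i : ℕ) : Finset (Fin K × ℕ × ℕ) :=
  Finset.univ ×ˢ Finset.range (i + 1) ×ˢ Finset.range N

theorem sum_smul_avg (i : ℕ) (a : ℕ → ℝ) (v : Fin K × ℕ × ℕ → Pt M₁ M₂) :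
    ∑ j ∈ Finset.range (i + 1), a j • avg N (fun k n => v (k, j, n))
      = ∑ s ∈ roundIdx K N i, (a s.2.1 * (1 / K) * (1 / N)) • v s := by
  rw [roundIdx, Finset.sum_product, Finset.sum_congr rfl fun k _ => Finset.sum_product _ _ _,
    Finset.sum_comm]
  refine Finset.sum_congr rfl fun j _ => ?_
  simp only [avg, Finset.smul_sum, smul_smul, mul_assoc]

/-- The `KN` samples of a round contribute `1/(KN)`, and the rounds a geometric sum of ratio `(1 -
β)² ≤ 1 - β`, at most `1/β`. With `A = β` this yields the `√β` of the gradient noise. -/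
theorem sqrt_sum_weights_le (hK : 0 < K) (hN : 0 < N) {β A v : ℝ} (hβ : 0 < β) (hβ1 : β ≤ 1)
    (hA : 0 ≤ A) (hv : 0 ≤ v) (i : ℕ) :
    √(∑ s ∈ roundIdx K N i, ((1 - β) ^ (i - s.2.1) * A * (1 / K) * (1 / N)) ^ 2 * v ^ 2)
      ≤ A * v / √(β * K * N) := by
  have hK' : (0 : ℝ) < K := by exact_mod_cast hK
  have hN' : (0 : ℝ) < N := by exact_mod_cast hN
  have e : ∑ s ∈ roundIdx K N i, ((1 - β) ^ (i - s.2.1) * A * (1 / K) * (1 / N)) ^ 2 * v ^ 2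
      = (A * v) ^ 2 / (K * N) * ∑ j ∈ Finset.range (i + 1), ((1 - β) ^ 2) ^ (i - j) := by
    rw [roundIdx, Finset.sum_product, Finset.sum_congr rfl fun k _ => Finset.sum_product _ _ _]
    simp only [Finset.sum_const, Finset.card_univ, Fintype.card_fin, Finset.card_range,
      nsmul_eq_mul, Finset.mul_sum]
    refine Finset.sum_congr rfl fun j _ => ?_
    rw [← pow_mul, mul_comm 2, pow_mul]
    field_simp
  have hs := sum_pow_sub_le (sq_nonneg (1 - β)) (β := β) (by nlinarith) hβ i
  rw [e]
  refine Real.sqrt_le_iff.2 ⟨by positivity, ?_⟩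
  rw [div_pow, Real.sq_sqrt (by positivity)]
  calc (A * v) ^ 2 / (K * N) * ∑ j ∈ Finset.range (i + 1), ((1 - β) ^ 2) ^ (i - j)
      ≤ (A * v) ^ 2 / (K * N) * (1 / β) := by gcongr
    _ = _ := by field_simp

/-- The momentum error `m_{i-1} - ∇J(z_{i-1})` held by the server at the beginning of round `i`. -/
def RunData.momErr (R : RunData M₁ M₂ K Ξ Ω) (prob : Problem M₁ M₂ K Ξ) (p : Params) (N i : ℕ)
    (ω : Ω) : Pt M₁ M₂ :=
  (R.state prob p N i ω).mom - grad prob.cost (R.state prob p N i ω).prev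

variable (R prob p N) in
/-- The accumulated Hessian noise. -/
def accHess (i : ℕ) (ω : Ω) : Pt M₁ M₂ :=
  ∑ s ∈ roundIdx K N i, ((1 - p.β) ^ (i - s.2.1) * (1 - p.β) * (1 / K) * (1 / N)) •
    hessNoise prob s.1
      (((R.state prob p N s.2.1 ω).cur, (R.state prob p N s.2.1 ω).prev), R.ξ s ω)

variable (R prob p N) in
/-- The accumulated gradient noise. -/
def accGrad (i : ℕ) (ω : Ω) : Pt M₁ M₂ :=
  ∑ s ∈ roundIdx K N i, ((1 - p.β) ^ (i - s.2.1) * p.β * (1 / K) * (1 / N)) •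
    gradNoise prob s.1 (localFn prob p N s (R.start ω, fun s => R.ξ s ω), R.ξ s ω)

/-- The unrolled recursion is split so that the bias is bounded term by term, whereas each noise sum
stays inside one norm; its cancellation is exploited only in expectation. -/
theorem norm_momErr_le (h : prob.Assumptions Lf Lh σ σh ν) (hR : R.Valid prob p ρ)
    (hK : 0 < K) (hN : 0 < N) (hx : 0 ≤ p.μx) (hy : 0 ≤ p.μy) (hlx : 0 ≤ p.locμx)
    (hly : 0 ≤ p.locμy) (hβ : 0 < p.β) (hβ1 : p.β ≤ 1) (hγ : p.γ = 1) :
    ∀ᵐ ω ∂ρ, ∀ i, ‖R.momErr prob p N (i + 1) ω‖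
      ≤ (1 - p.β) ^ (i + 1) * ‖R.momErr prob p N 0 ω‖
        + (Lh * (p.μx ^ 2 + p.μy ^ 2) / p.β + N * Lf * (p.locμx + p.locμy))
        + ‖accHess prob p N R i ω‖ + ‖accGrad prob p N R i ω‖ := by
  filter_upwards [norm_cur_sub_prev_sq_le (N := N) hR hx hy] with ω hω i
  have hq : 0 ≤ 1 - p.β := by linarith
  set D : ℕ → Pt M₁ M₂ := fun j =>
    (1 - p.β) • linErr prob (R.state prob p N j ω).cur (R.state prob p N j ω).prev
      + p.β • drift prob p N (R.state prob p N j ω).cur (fun k n => R.ξ (k, j, n) ω) with hD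
  set H : ℕ → Pt M₁ M₂ := fun j => avg N (fun k n => hessNoise prob k
    (((R.state prob p N j ω).cur, (R.state prob p N j ω).prev), R.ξ (k, j, n) ω)) with hH
  set G : ℕ → Pt M₁ M₂ := fun j => avg N (fun k n => gradNoise prob k
    (localIter prob p k (R.state prob p N j ω).cur (fun n => R.ξ (k, j, n) ω) n,
      R.ξ (k, j, n) ω)) with hG
  have hrec : ∀ j, R.momErr prob p N (j + 1) ω = (1 - p.β) • R.momErr prob p N j ω
      + (D j + (1 - p.β) • H j + p.β • G j) := fun j =>
    nextMom_sub_grad h.differentiable_localCost hN hγ (R.state prob p N j ω)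
      (fun k n => R.ξ (k, j, n) ω)
  have hsum := eq_pow_smul_add_sum (e := fun j => R.momErr prob p N j ω) hrec (i + 1)
  simp only [add_tsub_cancel_right, smul_add, Finset.sum_add_distrib, smul_smul] at hsum
  have eH : ∑ j ∈ Finset.range (i + 1), ((1 - p.β) ^ (i - j) * (1 - p.β)) • H j
      = accHess prob p N R i ω :=
    sum_smul_avg i (fun j => (1 - p.β) ^ (i - j) * (1 - p.β)) (fun s => hessNoise prob s.1
      (((R.state prob p N s.2.1 ω).cur, (R.state prob p N s.2.1 ω).prev), R.ξ s ω))
  have eG : ∑ j ∈ Finset.range (i + 1), ((1 - p.β) ^ (i - j) * p.β) • G j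
      = accGrad prob p N R i ω :=
    sum_smul_avg i (fun j => (1 - p.β) ^ (i - j) * p.β) (fun s => gradNoise prob s.1
      (localFn prob p N s (R.start ω, fun s => R.ξ s ω), R.ξ s ω))
  rw [eH, eG] at hsum
  set C := Lh * (p.μx ^ 2 + p.μy ^ 2) + p.β * (N * Lf * (p.locμx + p.locμy)) with hC
  have hLf := h.Lf_pos
  have hLh := h.Lh_nonneg
  have hC0 : 0 ≤ C := by positivity
  have hDj : ∀ j, ‖D j‖ ≤ C := fun j => by
    refine (norm_add_le _ _).trans ?_
    rw [norm_smul, norm_smul, Real.norm_of_nonneg hq, Real.norm_of_nonneg hβ.le]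
    refine add_le_add ?_ (mul_le_mul_of_nonneg_left (norm_drift_le h hK hN hlx hly _ _) hβ.le)
    refine (mul_le_of_le_one_left (norm_nonneg _) (by linarith)).trans ?_
    exact (norm_linErr_le h hK _ _).trans (mul_le_mul_of_nonneg_left (hω j) hLh)
  have hDs : ‖∑ j ∈ Finset.range (i + 1), (1 - p.β) ^ (i - j) • D j‖
      ≤ Lh * (p.μx ^ 2 + p.μy ^ 2) / p.β + N * Lf * (p.locμx + p.locμy) := by
    calc ‖∑ j ∈ Finset.range (i + 1), (1 - p.β) ^ (i - j) • D j‖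
        ≤ ∑ j ∈ Finset.range (i + 1), (1 - p.β) ^ (i - j) * C :=
          norm_sum_le_of_le _ fun j _ => by
            rw [norm_smul, Real.norm_of_nonneg (by positivity)]
            exact mul_le_mul_of_nonneg_left (hDj j) (by positivity)
      _ ≤ 1 / p.β * C := by
          rw [← Finset.sum_mul]
          exact mul_le_mul_of_nonneg_right (sum_pow_sub_le hq le_rfl hβ i) hC0
      _ = _ := by rw [hC]; field_simp
  rw [hsum]
  have h0 : ‖(1 - p.β) ^ (i + 1) • R.momErr prob p N 0 ω‖
      = (1 - p.β) ^ (i + 1) * ‖R.momErr prob p N 0 ω‖ := by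
    rw [norm_smul, Real.norm_of_nonneg (by positivity)]
  rw [← h0]
  set A := ∑ j ∈ Finset.range (i + 1), (1 - p.β) ^ (i - j) • D j
  linarith [norm_add_le ((1 - p.β) ^ (i + 1) • R.momErr prob p N 0 ω)
      (A + accHess prob p N R i ω + accGrad prob p N R i ω),
    norm_add_le (A + accHess prob p N R i ω) (accGrad prob p N R i ω),
    norm_add_le A (accHess prob p N R i ω)]

/-- The index `i + 1` refers to `m_i - ∇J(z_i)`, the error of the direction used in round `i`. -/
theorem integral_norm_momErr_le [IsProbabilityMeasure ρ] (h : prob.Assumptions Lf Lh σ σh ν)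
    (hR : R.Valid prob p ρ) (hK : 0 < K) (hN : 0 < N) (hx : 0 ≤ p.μx) (hy : 0 ≤ p.μy)
    (hlx : 0 ≤ p.locμx) (hly : 0 ≤ p.locμy) (hβ : 0 < p.β) (hβ1 : p.β ≤ 1) (hγ : p.γ = 1)
    (i : ℕ) :
    Integrable (fun ω => ‖R.momErr prob p N (i + 1) ω‖) ρ ∧
    ∫ ω, ‖R.momErr prob p N (i + 1) ω‖ ∂ρ ≤ (1 - p.β) ^ (i + 1) * (σ / √(K : ℝ))
      + (Lh * (p.μx ^ 2 + p.μy ^ 2) / p.β + N * Lf * (p.locμx + p.locμy))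
      + σh * (p.μx + p.μy) / √(p.β * K * N) + √p.β / √((K : ℝ) * N) * σ := by
  have hq : 0 ≤ 1 - p.β := by linarith
  have hK' : (0 : ℝ) < K := by exact_mod_cast hK
  have hN' : (0 : ℝ) < N := by exact_mod_cast hN
  obtain ⟨i0, b0⟩ := init_noise_le h hR hK
  obtain ⟨iH, bH⟩ := hess_noise_le (N := N) h hR hx hy (roundIdx K N i)
    (fun s => (1 - p.β) ^ (i - s.2.1) * (1 - p.β) * (1 / K) * (1 / N))
  obtain ⟨iG, bG⟩ := grad_noise_le (N := N) h hR (roundIdx K N i)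
    (fun s => (1 - p.β) ^ (i - s.2.1) * p.β * (1 / K) * (1 / N))
  have i0' : Integrable (fun ω => ‖R.momErr prob p N 0 ω‖) ρ := i0.norm
  have b0' : ∫ ω, ‖R.momErr prob p N 0 ω‖ ∂ρ ≤ σ / √(K : ℝ) := b0
  have iH' : Integrable (fun ω => ‖accHess prob p N R i ω‖) ρ := iH.norm
  have iG' : Integrable (fun ω => ‖accGrad prob p N R i ω‖) ρ := iG.norm
  have bH' : ∫ ω, ‖accHess prob p N R i ω‖ ∂ρ ≤ σh * (p.μx + p.μy) / √(p.β * K * N) := by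
    have hs : σh ^ 2 * (p.μx ^ 2 + p.μy ^ 2) ≤ (σh * (p.μx + p.μy)) ^ 2 := by
      rw [mul_pow]
      gcongr
      nlinarith
    have hσ := h.σh_nonneg
    refine bH.trans ((Real.sqrt_le_sqrt (Finset.sum_le_sum fun s _ =>
      mul_le_mul_of_nonneg_left hs (sq_nonneg _))).trans
      ((sqrt_sum_weights_le (v := σh * (p.μx + p.μy)) hK hN hβ hβ1 hq (by positivity) i).trans ?_))
    refine div_le_div_of_nonneg_right ?_ (Real.sqrt_nonneg _)
    exact mul_le_of_le_one_left (by positivity) (by linarith)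
  have bG' : ∫ ω, ‖accGrad prob p N R i ω‖ ∂ρ ≤ √p.β / √((K : ℝ) * N) * σ := by
    refine bG.trans ((sqrt_sum_weights_le hK hN hβ hβ1 hβ.le h.σ_nonneg i).trans_eq ?_)
    rw [mul_assoc p.β, Real.sqrt_mul hβ.le]
    have h1 : 0 < √p.β := Real.sqrt_pos.2 hβ
    have h2 : 0 < √((K : ℝ) * N) := Real.sqrt_pos.2 (by positivity)
    have h3 : p.β = √p.β * √p.β := (Real.mul_self_sqrt hβ.le).symm
    nth_rewrite 1 [h3]
    field_simp
  have hmeas : Measurable (R.momErr prob p N (i + 1)) := by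
    obtain ⟨-, h2, h3⟩ := hR.measurable_state (N := N) h.wellPosed (i + 1)
    refine h3.sub (Measurable.comp ?_ h2)
    have : grad prob.cost = fun z => (1 / (K : ℝ)) • ∑ k, grad (prob.localCost k) z :=
      funext fun z => grad_cost h.differentiable_localCost z
    change Measurable (grad prob.cost)
    rw [this]
    exact measurable_smul_pt _ (Finset.measurable_fun_sum _ fun k _ =>
      (continuous_grad_localCost h k).measurable)
  set c := Lh * (p.μx ^ 2 + p.μy ^ 2) / p.β + N * Lf * (p.locμx + p.locμy)
  have int1 : Integrable (fun ω => (1 - p.β) ^ (i + 1) * ‖R.momErr prob p N 0 ω‖ + c) ρ :=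
    (i0'.const_mul _).add (integrable_const c)
  have int2 : Integrable (fun ω => (1 - p.β) ^ (i + 1) * ‖R.momErr prob p N 0 ω‖ + c
      + ‖accHess prob p N R i ω‖) ρ := int1.add iH'
  have hint : Integrable (fun ω => (1 - p.β) ^ (i + 1) * ‖R.momErr prob p N 0 ω‖ + c
      + ‖accHess prob p N R i ω‖ + ‖accGrad prob p N R i ω‖) ρ := int2.add iG'
  have hle : ∀ᵐ ω ∂ρ, ‖R.momErr prob p N (i + 1) ω‖ ≤ (1 - p.β) ^ (i + 1) *
      ‖R.momErr prob p N 0 ω‖ + c + ‖accHess prob p N R i ω‖ + ‖accGrad prob p N R i ω‖ := by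
    filter_upwards [norm_momErr_le h hR hK hN hx hy hlx hly hβ hβ1 hγ] with ω hω
    exact hω i
  have hI : Integrable (fun ω => ‖R.momErr prob p N (i + 1) ω‖) ρ :=
    hint.mono' hmeas.norm.aestronglyMeasurable (by simpa only [norm_norm] using hle)
  refine ⟨hI, (integral_mono_ae hI hint hle).trans ?_⟩
  rw [integral_add int2 iG', integral_add int1 iH', integral_add (i0'.const_mul _) (integrable_const c), integral_const_mul, integral_const,
    probReal_univ, one_smul]
  gcongr

/-- The bracket of the explicit bound. -/
def noiseBound (Lf Lh σ σh : ℝ) (p : Params) (K N T : ℕ) : ℝ :=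
  σ / (T * √(K : ℝ) * p.β) + Lh * (p.μx ^ 2 + p.μy ^ 2) / (2 * p.β)
    + N * Lf * (p.locμx + p.locμy) / 2 + σh * (p.μx + p.μy) / √(p.β * K * N)
    + √p.β / √((K : ℝ) * N) * σ

/-- The initial error is forgotten geometrically, so over all rounds it costs only `1/β`. The factor
`2` compensates the halves carried by the two bias terms of `noiseBound`. -/
theorem sum_integral_momErr_le [IsProbabilityMeasure ρ] (h : prob.Assumptions Lf Lh σ σh ν)
    (hR : R.Valid prob p ρ) (hK : 0 < K) (hN : 0 < N) (hx : 0 ≤ p.μx) (hy : 0 ≤ p.μy)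
    (hlx : 0 ≤ p.locμx) (hly : 0 ≤ p.locμy) (hβ : 0 < p.β) (hβ1 : p.β ≤ 1) (hγ : p.γ = 1)
    {T : ℕ} (hT : 0 < T) :
    ∑ i ∈ Finset.range T, ∫ ω, ‖R.momErr prob p N (i + 1) ω‖ ∂ρ
      ≤ T * (2 * noiseBound Lf Lh σ σh p K N T) := by
  have hq : 0 ≤ 1 - p.β := by linarith
  have hT' : (0 : ℝ) < T := by exact_mod_cast hT
  have hK' : (0 : ℝ) < K := by exact_mod_cast hK
  have hσ := h.σ_nonneg
  have hσh := h.σh_nonneg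
  refine (Finset.sum_le_sum fun i _ => (integral_norm_momErr_le h hR hK hN hx hy hlx hly hβ hβ1
    hγ i).2).trans ?_
  simp only [Finset.sum_add_distrib, Finset.sum_const, Finset.card_range, nsmul_eq_mul,
    ← Finset.sum_mul]
  have hgeo : ∑ i ∈ Finset.range T, (1 - p.β) ^ (i + 1) ≤ 1 / p.β := by
    obtain ⟨T', rfl⟩ : ∃ T', T = T' + 1 := ⟨T - 1, by omega⟩
    have h1 := sum_pow_sub_le hq le_rfl hβ T'
    have h2 := Finset.sum_range_reflect (fun j => (1 - p.β) ^ j) (T' + 1)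
    simp only [add_tsub_cancel_right] at h2
    rw [h2] at h1
    refine (Finset.sum_le_sum fun i _ => ?_).trans h1
    exact pow_le_pow_of_le_one hq (by linarith) (Nat.le_succ i)
  have h0 : (∑ i ∈ Finset.range T, (1 - p.β) ^ (i + 1)) * (σ / √(K : ℝ))
      ≤ T * (σ / (T * √(K : ℝ) * p.β)) := by
    refine (mul_le_mul_of_nonneg_right hgeo (by positivity)).trans_eq ?_
    have : 0 < √(K : ℝ) := Real.sqrt_pos.2 hK'
    field_simp
  have e1 : Lh * (p.μx ^ 2 + p.μy ^ 2) / (2 * p.β) = Lh * (p.μx ^ 2 + p.μy ^ 2) / p.β / 2 := by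
    field_simp
  rw [noiseBound, e1]
  have p0 : 0 ≤ T * (σ / (T * √(K : ℝ) * p.β)) := by positivity
  have p1 : 0 ≤ T * (σh * (p.μx + p.μy) / √(p.β * K * N)) := by positivity
  have p2 : 0 ≤ T * (√p.β / √((K : ℝ) * N) * σ) := by positivity
  linarith

theorem measurable_stat (h : prob.Assumptions Lf Lh σ σh ν) (hR : R.Valid prob p ρ) (hK : 0 < K)
    (i : ℕ) : Measurable (R.stat prob p N i) := by
  have h1 : Measurable (R.iter prob p N i) := (hR.measurable_state (N := N) h.wellPosed i).1
  have hc : Continuous (grad prob.cost) :=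
    (LipschitzWith.of_dist_le_mul (K := ⟨Lf, h.Lf_pos.le⟩) fun z w => by
      rw [dist_eq_norm, dist_eq_norm]; exact (h.smoothPL hK).lip z w).continuous
  have h2 : Measurable fun ω => grad prob.cost (R.iter prob p N i ω) := hc.measurable.comp h1
  exact (measurable_fst_pt h2).norm.add (measurable_snd_pt h2).norm

theorem envGap₀_nonneg [IsProbabilityMeasure ρ] (h : prob.Assumptions Lf Lh σ σh ν)
    (hR : R.Valid prob p ρ) (hK : 0 < K) :
    0 ≤ R.envGap₀ prob ρ := by
  have : ∫ _, prob.envelopeInf ∂ρ ≤ ∫ ω, prob.envelope (R.z₀ ω).fst ∂ρ :=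
    integral_mono (integrable_const _) hR.integrable_envelope
      fun ω => (h.smoothPL hK).envelopeInf_le _
  rw [integral_const, probReal_univ, one_smul] at this
  exact sub_nonneg.2 this

theorem explicit_bound [IsProbabilityMeasure ρ] (h : prob.Assumptions Lf Lh σ σh ν)
    (hR : R.Valid prob p ρ) (hK : 0 < K) (hN : 0 < N) {T : ℕ} (hT : 0 < T) (hx : 0 < p.μx)
    (hxy : p.μx ≤ p.μy / (6 * (Lf / ν)))
    (hlx : 0 ≤ p.locμx) (hly : 0 ≤ p.locμy) (hβ : 0 < p.β) (hβ1 : p.β ≤ 1) (hγ : p.γ = 1) :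
    (∀ i < T, Integrable (R.stat prob p N i) ρ) ∧
      R.avgStat prob p ρ N T ≤ explicitBound Lf Lh σ σh (Lf / ν) p K N T
        (R.envGap₀ prob ρ) (R.dist₀ prob ρ) (R.gap₀ prob ρ) := by
  have hs := h.smoothPL hK
  have hLf := h.Lf_pos
  have hν := h.ν_pos
  have hLh := h.Lh_nonneg
  have hσ := h.σ_nonneg
  have hσh := h.σh_nonneg
  have hT' : (0 : ℝ) < T := by exact_mod_cast hT
  set κ := Lf / ν with hκdef
  have hκ : 0 < κ := by positivity
  have hy : 0 < p.μy := by
    rw [le_div_iff₀ (by positivity)] at hxy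
    exact lt_of_lt_of_le (by positivity) hxy
  have hpath : ∀ ω, ∑ i ∈ Finset.range T, R.stat prob p N i ω
      ≤ (prob.envelope (R.z₀ ω).fst - prob.envelopeInf) / p.μx
        + 6 * κ * prob.gap (R.z₀ ω) / p.μy
        + (2 + 12 * κ) * ∑ i ∈ Finset.range T, ‖R.momErr prob p N (i + 1) ω‖
        + T * Lf * (1 + 8 * κ) * p.μx + 6 * κ * T * Lf * p.μy := fun ω =>
    hs.sum_stat_le hx hxy (fun i => R.iter prob p N i ω)
      (fun i => (R.state prob p N (i + 1) ω).mom) (fun i => rfl) T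
  have hme := fun i => (integral_norm_momErr_le h hR hK hN hx.le hy.le hlx hly hβ hβ1 hγ i).1
  have iP : Integrable (fun ω => (prob.envelope (R.z₀ ω).fst - prob.envelopeInf) / p.μx) ρ :=
    (integrable_sub_const hR.integrable_envelope _).div_const _
  have iΔ : Integrable (fun ω => 6 * κ * prob.gap (R.z₀ ω) / p.μy) ρ :=
    (hR.integrable_gap.const_mul _).div_const _
  have iE : Integrable (fun ω => (2 + 12 * κ) *
      ∑ i ∈ Finset.range T, ‖R.momErr prob p N (i + 1) ω‖) ρ :=
    (integrable_finsetSum _ fun i _ => hme i).const_mul _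
  have iPΔ : Integrable (fun ω => (prob.envelope (R.z₀ ω).fst - prob.envelopeInf) / p.μx
        + 6 * κ * prob.gap (R.z₀ ω) / p.μy) ρ := iP.add iΔ
  have iPΔE : Integrable (fun ω => (prob.envelope (R.z₀ ω).fst - prob.envelopeInf) / p.μx
        + 6 * κ * prob.gap (R.z₀ ω) / p.μy
        + (2 + 12 * κ) * ∑ i ∈ Finset.range T, ‖R.momErr prob p N (i + 1) ω‖) ρ := iPΔ.add iE
  have iB₁ : Integrable (fun ω => (prob.envelope (R.z₀ ω).fst - prob.envelopeInf) / p.μx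
        + 6 * κ * prob.gap (R.z₀ ω) / p.μy
        + (2 + 12 * κ) * ∑ i ∈ Finset.range T, ‖R.momErr prob p N (i + 1) ω‖
        + T * Lf * (1 + 8 * κ) * p.μx) ρ := iPΔE.add (integrable_const _)
  have iB : Integrable (fun ω => (prob.envelope (R.z₀ ω).fst - prob.envelopeInf) / p.μx
        + 6 * κ * prob.gap (R.z₀ ω) / p.μy
        + (2 + 12 * κ) * ∑ i ∈ Finset.range T, ‖R.momErr prob p N (i + 1) ω‖
        + T * Lf * (1 + 8 * κ) * p.μx + 6 * κ * T * Lf * p.μy) ρ := iB₁.add (integrable_const _)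
  -- Integrability needs no separate argument: each term is nonnegative, hence dominated by the
  -- integrable pathwise bound on the sum.
  have hint : ∀ i < T, Integrable (R.stat prob p N i) ρ := fun i hi => by
    refine iB.mono' (measurable_stat h hR hK i).aestronglyMeasurable (.of_forall fun ω => ?_)
    have stat_nonneg : ∀ j, 0 ≤ R.stat prob p N j ω := fun j =>
      add_nonneg (norm_nonneg _) (norm_nonneg _)
    rw [Real.norm_of_nonneg (stat_nonneg i)]
    exact (Finset.single_le_sum (f := fun i => R.stat prob p N i ω)
      (fun j _ => stat_nonneg j) (Finset.mem_range.2 hi)).trans (hpath ω)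
  refine ⟨hint, ?_⟩
  have hsum : ∑ i ∈ Finset.range T, ∫ ω, R.stat prob p N i ω ∂ρ
      ≤ R.envGap₀ prob ρ / p.μx + 6 * κ * R.gap₀ prob ρ / p.μy
        + (2 + 12 * κ) * (T * (2 * noiseBound Lf Lh σ σh p K N T))
        + T * Lf * (1 + 8 * κ) * p.μx + 6 * κ * T * Lf * p.μy := by
    rw [← integral_finsetSum _ fun i hi => hint i (Finset.mem_range.1 hi)]
    refine (integral_mono (integrable_finsetSum _ fun i hi => hint i (Finset.mem_range.1 hi)) iB
      hpath).trans ?_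
    rw [integral_add iB₁ (integrable_const _), integral_add iPΔE (integrable_const _),
      integral_add iPΔ iE,
      integral_add iP iΔ, integral_div, integral_div, integral_const_mul, integral_const_mul,
      integral_sub hR.integrable_envelope (integrable_const _),
      integral_finsetSum _ fun i _ => hme i]
    simp only [integral_const, probReal_univ, one_smul]
    have := sum_integral_momErr_le h hR hK hN hx.le hy.le hlx hly hβ hβ1 hγ hT
    rw [RunData.envGap₀, RunData.gap₀]
    gcongr
  have hE0 := envGap₀_nonneg h hR hK
  have hd0 : 0 ≤ R.dist₀ prob ρ := integral_nonneg fun ω => Metric.infDist_nonneg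
  have hg0 : 0 ≤ R.gap₀ prob ρ := integral_nonneg fun ω => hs.gap_nonneg _
  have hn0 : 0 ≤ noiseBound Lf Lh σ σh p K N T := by
    rw [noiseBound]
    positivity
  rw [RunData.avgStat]
  refine (mul_le_mul_of_nonneg_left hsum (by positivity)).trans ?_
  have e : explicitBound Lf Lh σ σh κ p K N T (R.envGap₀ prob ρ) (R.dist₀ prob ρ) (R.gap₀ prob ρ)
      = 3 * (R.envGap₀ prob ρ / (p.μx * T)) + 20 * Lf * R.dist₀ prob ρ / T
        + 60 * (κ * R.gap₀ prob ρ / (p.μy * T)) + C₁ Lf κ * p.μx + C₂ Lf κ * p.μy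
        + C₃ κ * noiseBound Lf Lh σ σh p K N T := by
    rw [explicitBound, noiseBound]
    ring
  rw [e]
  have e2 : 1 / (T : ℝ) * (R.envGap₀ prob ρ / p.μx + 6 * κ * R.gap₀ prob ρ / p.μy
        + (2 + 12 * κ) * (T * (2 * noiseBound Lf Lh σ σh p K N T))
        + T * Lf * (1 + 8 * κ) * p.μx + 6 * κ * T * Lf * p.μy)
      = R.envGap₀ prob ρ / (p.μx * T) + 6 * (κ * R.gap₀ prob ρ / (p.μy * T))
        + (4 + 24 * κ) * noiseBound Lf Lh σ σh p K N T
        + Lf * (1 + 8 * κ) * p.μx + 6 * κ * Lf * p.μy := by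
    field_simp
    ring
  rw [e2, C₁, C₂, C₃]
  have q1 : 0 ≤ R.envGap₀ prob ρ / (p.μx * T) := by positivity
  have q2 : 0 ≤ κ * R.gap₀ prob ρ / (p.μy * T) := by positivity
  -- The distance term does not arise from the pathwise bound; being nonnegative, it only enlarges
  -- the right-hand side.
  have q3 : 0 ≤ 20 * Lf * R.dist₀ prob ρ / T := by positivity
  have q4 : 0 ≤ κ * noiseBound Lf Lh σ σh p K N T := by positivity
  have q5 : 0 ≤ Lf * p.μx := by positivity
  have q6 : 0 ≤ κ * Lf * p.μx := by positivity
  have q7 : 0 ≤ Lf * p.μy := by positivity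
  have q8 : 0 ≤ κ * Lf * p.μy := by positivity
  linarith

end MomentumErrorBound

/-! ### Substituting step sizes of order `s` into the explicit bound. -/

section Rate

variable {K N T : ℕ}

theorem scale_pos (hK : 0 < K) (hN : 0 < N) (hT : 0 < T) : 0 < scale K N T := by
  have hK' : (0 : ℝ) < K := by exact_mod_cast hK
  have hN' : (0 : ℝ) < N := by exact_mod_cast hN
  have hT' : (0 : ℝ) < T := by exact_mod_cast hT
  rw [scale]; positivity

/-- The statistical part `1 / (NKT)^{1/3}` of the rate. -/
def statRate (K N T : ℕ) : ℝ := 1 / ((N : ℝ) * K * T) ^ (1 / 3 : ℝ)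

theorem statRate_pos (hK : 0 < K) (hN : 0 < N) (hT : 0 < T) : 0 < statRate K N T := by
  have hK' : (0 : ℝ) < K := by exact_mod_cast hK
  have hN' : (0 : ℝ) < N := by exact_mod_cast hN
  have hT' : (0 : ℝ) < T := by exact_mod_cast hT
  rw [statRate]; positivity

theorem rate_eq (κ : ℝ) (K N T : ℕ) : rate κ K N T = κ * (statRate K N T + scale K N T) := by
  rw [rate, statRate, scale]; ring

theorem one_div_scale_mul (hK : 0 < K) (hN : 0 < N) (hT : 0 < T) :
    1 / (scale K N T * T) = statRate K N T := by
  have hK' : (0 : ℝ) < K := by exact_mod_cast hK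
  have hN' : (0 : ℝ) < N := by exact_mod_cast hN
  have hT' : (0 : ℝ) < T := by exact_mod_cast hT
  rw [scale, statRate, Real.mul_rpow (by positivity) hT'.le]
  have e : (T : ℝ) = (T : ℝ) ^ (1 / 3 : ℝ) * (T : ℝ) ^ (2 / 3 : ℝ) := by
    rw [← Real.rpow_add hT']; norm_num
  have h1 : 0 < (T : ℝ) ^ (2 / 3 : ℝ) := by positivity
  congr 1
  rw [div_mul_eq_mul_div, div_eq_iff h1.ne', mul_assoc, ← e]

/-- Consequently `√s / √(KN)` equals the statistical rate, which is the size of both noise terms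
when `β` and the step sizes are of order `s`. -/
theorem scale_eq (hK : 0 < K) (hN : 0 < N) (hT : 0 < T) :
    scale K N T = (K * N) * statRate K N T ^ 2 := by
  have hK' : (0 : ℝ) < K := by exact_mod_cast hK
  have hN' : (0 : ℝ) < N := by exact_mod_cast hN
  have hT' : (0 : ℝ) < T := by exact_mod_cast hT
  rw [scale, statRate, div_pow, one_pow, ← Real.rpow_natCast, ← Real.rpow_mul (by positivity),
    Real.mul_rpow (by positivity) hT'.le]
  have hNK : (0 : ℝ) < N * K := by positivity
  have e : (K : ℝ) * N = ((N : ℝ) * K) ^ (1 / 3 : ℝ) * ((N : ℝ) * K) ^ (2 / 3 : ℝ) := by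
    rw [← Real.rpow_add hNK]; norm_num; ring
  rw [e]
  norm_num
  field_simp

theorem one_div_le_scale (hK : 0 < K) (hN : 0 < N) (hT : 0 < T) : 1 / (T : ℝ) ≤ scale K N T := by
  have hK' : (1 : ℝ) ≤ K := by exact_mod_cast hK
  have hN' : (1 : ℝ) ≤ N := by exact_mod_cast hN
  have hT' : (1 : ℝ) ≤ T := by exact_mod_cast hT
  rw [scale]
  have h1 : (1 : ℝ) ≤ ((N : ℝ) * K) ^ (1 / 3 : ℝ) :=
    Real.one_le_rpow (by nlinarith) (by norm_num)
  have h2 : (T : ℝ) ^ (2 / 3 : ℝ) ≤ T := by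
    conv_rhs => rw [← Real.rpow_one (T : ℝ)]
    exact Real.rpow_le_rpow_of_exponent_le hT' (by norm_num)
  gcongr

theorem scale_le_one (hT : 0 < T) (h : N * K ≤ T ^ 2) : scale K N T ≤ 1 := by
  have hT' : (0 : ℝ) < T := by exact_mod_cast hT
  have h' : (N : ℝ) * K ≤ (T : ℝ) ^ 2 := by exact_mod_cast h
  rw [scale, div_le_one (by positivity)]
  calc ((N : ℝ) * K) ^ (1 / 3 : ℝ) ≤ ((T : ℝ) ^ 2) ^ (1 / 3 : ℝ) := by gcongr
    _ = (T : ℝ) ^ (2 / 3 : ℝ) := by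
      rw [← Real.rpow_natCast, ← Real.rpow_mul hT'.le]; norm_num

/-- The constant in the rate. -/
def rateConst (Lf Lh σ σh D A a b : ℝ) : ℝ :=
  63 * A + 20 * Lf * D + 307 * Lf * b
    + 168 * (σ / a + Lh * b ^ 2 / a + b + 2 * σh * b / √a + √b * σ)

/-- Lower bounds on the server steps enter only through `E₀ / μx` and `Δ₀ / μy`. This form also
serves steps proportional to `E₀` and `Δ₀`, which may be arbitrarily small. -/
theorem explicitBound_le_rate {Lf Lh σ σh κ D A a b E₀ d₀ Δ₀ : ℝ} {p : Params} (hK : 0 < K)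
    (hN : 0 < N) (hT : 0 < T) (hLf : 0 < Lf) (hLh : 0 ≤ Lh) (hσ : 0 ≤ σ) (hσh : 0 ≤ σh)
    (hκ : 1 ≤ κ) (ha : 0 < a) (hA : 0 ≤ A) (hd : d₀ ≤ D) (hD : 0 ≤ D)
    (hx0 : 0 < p.μx) (hy0 : 0 < p.μy)
    (hE : E₀ / p.μx ≤ A * κ / scale K N T) (hΔ : Δ₀ / p.μy ≤ A / scale K N T)
    (hβ : a * scale K N T ≤ p.β) (hβ' : p.β ≤ b * scale K N T)
    (hy : p.μy ≤ b * scale K N T) (hx : p.μx ≤ b * scale K N T / κ)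
    (hlx : p.locμx = p.μx / (N * Lf)) (hly : p.locμy = p.μy / (N * Lf)) :
    explicitBound Lf Lh σ σh κ p K N T E₀ d₀ Δ₀
      ≤ rateConst Lf Lh σ σh D A a b * rate κ K N T := by
  have hK' : (1 : ℝ) ≤ K := by exact_mod_cast hK
  have hN' : (0 : ℝ) < N := by exact_mod_cast hN
  have hT' : (0 : ℝ) < T := by exact_mod_cast hT
  have hs := scale_pos hK hN hT
  have hr := statRate_pos hK hN hT
  have hsT := one_div_scale_mul hK hN hT
  have hse := scale_eq hK hN hT
  have hTs := one_div_le_scale hK hN hT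
  rw [rate_eq]
  set s := scale K N T
  set r := statRate K N T
  have hβ0 : 0 < p.β := lt_of_lt_of_le (by positivity) hβ
  -- Positivity of `b` follows from `0 < a s ≤ β ≤ b s`.
  have hb : 0 < b := by
    by_contra hc
    push Not at hc
    linarith [mul_nonpos_of_nonpos_of_nonneg hc hs.le]
  have hκ0 : 0 < κ := by linarith
  have hx' : p.μx ≤ b * s :=
    hx.trans (div_le_self (by positivity) hκ)
  have hκx : κ * p.μx ≤ b * s := by
    rw [le_div_iff₀ hκ0] at hx; linarith
  have hκr : r ≤ κ * r := le_mul_of_one_le_left hr.le hκ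
  have hκs : s ≤ κ * s := le_mul_of_one_le_left hs.le hκ
  have t1 : 3 * E₀ / (p.μx * T) ≤ 3 * A * (κ * r) := by
    calc 3 * E₀ / (p.μx * T) = 3 * (E₀ / p.μx) / T := by field_simp
      _ ≤ 3 * (A * κ / s) / T := by gcongr
      _ = 3 * A * (κ * (1 / (s * T))) := by field_simp
      _ = _ := by rw [hsT]
  have t2 : 20 * Lf * d₀ / T ≤ 20 * Lf * D * (κ * s) := by
    calc 20 * Lf * d₀ / T ≤ 20 * Lf * D / T := by gcongr
      _ = 20 * Lf * D * (1 / T) := by ring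
      _ ≤ 20 * Lf * D * (κ * s) := by gcongr; linarith
  have t3 : 60 * κ * Δ₀ / (p.μy * T) ≤ 60 * A * (κ * r) := by
    calc 60 * κ * Δ₀ / (p.μy * T) = 60 * κ * (Δ₀ / p.μy) / T := by field_simp
      _ ≤ 60 * κ * (A / s) / T := by gcongr
      _ = 60 * A * (κ * (1 / (s * T))) := by field_simp
      _ = _ := by rw [hsT]
  have t4 : C₁ Lf κ * p.μx ≤ 257 * Lf * b * (κ * s) := by
    -- With `κ ≥ 1` constant terms are absorbed into multiples of `κ`; the value `257` is not sharp.
    -- The factor `κ` is then paid for by `κ μx ≤ b s`.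
    have h1 : C₁ Lf κ ≤ 257 * Lf * κ := by
      rw [C₁]; nlinarith [mul_le_mul_of_nonneg_left hκ hLf.le]
    calc C₁ Lf κ * p.μx ≤ 257 * Lf * κ * p.μx := by gcongr
      _ = 257 * Lf * (κ * p.μx) := by ring
      _ ≤ 257 * Lf * (b * (κ * s)) := by
        refine mul_le_mul_of_nonneg_left ?_ (by positivity)
        exact hκx.trans (mul_le_mul_of_nonneg_left hκs hb.le)
      _ = _ := by ring
  have t5 : C₂ Lf κ * p.μy ≤ 50 * Lf * b * (κ * s) := by
    have h1 : C₂ Lf κ ≤ 50 * Lf * κ := by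
      rw [C₂]; nlinarith [mul_le_mul_of_nonneg_left hκ hLf.le]
    calc C₂ Lf κ * p.μy ≤ 50 * Lf * κ * (b * s) := by gcongr
      _ = _ := by ring
  have u1 : σ / (T * √(K : ℝ) * p.β) ≤ σ / a * (r + s) := by
    have h1 : (1 : ℝ) ≤ √(K : ℝ) := Real.one_le_sqrt.2 hK'
    calc σ / (T * √(K : ℝ) * p.β) ≤ σ / (T * 1 * (a * s)) := by gcongr
      _ = σ / a * (1 / (s * T)) := by field_simp
      _ = σ / a * r := by rw [hsT]
      _ ≤ _ := by gcongr; linarith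
  have u2 : Lh * (p.μx ^ 2 + p.μy ^ 2) / (2 * p.β) ≤ Lh * b ^ 2 / a * (r + s) := by
    calc Lh * (p.μx ^ 2 + p.μy ^ 2) / (2 * p.β)
        ≤ Lh * ((b * s) ^ 2 + (b * s) ^ 2) / (2 * (a * s)) := by gcongr
      _ = Lh * b ^ 2 / a * s := by field_simp; ring
      _ ≤ _ := by gcongr; linarith
  have u3 : N * Lf * (p.locμx + p.locμy) / 2 ≤ b * (r + s) := by
    rw [hlx, hly]
    have e : (N : ℝ) * Lf * (p.μx / (N * Lf) + p.μy / (N * Lf)) / 2 = (p.μx + p.μy) / 2 := by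
      field_simp
    rw [e]
    have : 0 ≤ b * r := by positivity
    linarith
  have hKN : (0 : ℝ) < K * N := by positivity
  have hsq : √s = √((K : ℝ) * N) * r := by
    rw [hse, Real.sqrt_mul hKN.le, Real.sqrt_sq hr.le]
  have hqp : 0 < √((K : ℝ) * N) := Real.sqrt_pos.2 hKN
  have hss : s = √s * √s := (Real.mul_self_sqrt hs.le).symm
  have hsqp : 0 < √s := Real.sqrt_pos.2 hs
  have u4 : σh * (p.μx + p.μy) / √(p.β * K * N) ≤ 2 * σh * b / √a * (r + s) := by
    have hap : 0 < √a := Real.sqrt_pos.2 ha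
    calc σh * (p.μx + p.μy) / √(p.β * K * N)
        ≤ σh * (b * s + b * s) / √(a * s * (K * N)) := by
          rw [mul_assoc p.β]; gcongr
      _ = 2 * σh * b / √a * (√s / √((K : ℝ) * N)) := by
          rw [Real.sqrt_mul (by positivity), Real.sqrt_mul ha.le]
          nth_rewrite 1 2 [hss]
          field_simp
          ring
      _ = 2 * σh * b / √a * r := by rw [hsq]; field_simp
      _ ≤ _ := by gcongr; linarith
  have u5 : √p.β / √((K : ℝ) * N) * σ ≤ √b * σ * (r + s) := by
    calc √p.β / √((K : ℝ) * N) * σ ≤ √(b * s) / √((K : ℝ) * N) * σ := by gcongr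
      _ = √b * σ * r := by rw [Real.sqrt_mul hb.le, hsq]; field_simp
      _ ≤ _ := by gcongr; linarith
  have hC₃ : C₃ κ ≤ 168 * κ := by rw [C₃]; linarith
  have hC₃0 : 0 ≤ C₃ κ := by rw [C₃]; linarith
  have t6 : C₃ κ * (σ / (T * √(K : ℝ) * p.β) + Lh * (p.μx ^ 2 + p.μy ^ 2) / (2 * p.β)
        + N * Lf * (p.locμx + p.locμy) / 2 + σh * (p.μx + p.μy) / √(p.β * K * N)
        + √p.β / √((K : ℝ) * N) * σ)
      ≤ 168 * κ * ((σ / a + Lh * b ^ 2 / a + b + 2 * σh * b / √a + √b * σ) * (r + s)) := by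
    refine mul_le_mul hC₃ (by linarith) ?_ (by positivity)
    have h1 : 0 ≤ p.locμx := by rw [hlx]; positivity
    have h2 : 0 ≤ p.locμy := by rw [hly]; positivity
    positivity
  have p1 : 0 ≤ A * (κ * s) := by positivity
  have p2 : 0 ≤ Lf * D * (κ * r) := by positivity
  have p3 : 0 ≤ Lf * b * (κ * r) := by positivity
  rw [explicitBound, rateConst]
  linarith

end Rate

/-! ### The two rate statements. -/

section Main

variable {M₁ M₂ K N T : ℕ} {Ξ Ω : Type*} [MeasurableSpace Ξ] [MeasurableSpace Ω]
  {prob : Problem M₁ M₂ K Ξ} {Lf Lh σ σh ν : ℝ} {p : Params} {ρ : Measure Ω}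
  [IsProbabilityMeasure ρ] {R : RunData M₁ M₂ K Ξ Ω}

theorem avgStat_le_rate_of_le_scale {D a b : ℝ} (ha : 0 < a) (hK : 0 < K) (hN : 0 < N)
    (hT : 0 < T) (h : prob.Assumptions Lf Lh σ σh ν) (hν : ν ≤ Lf) (hR : R.Valid prob p ρ)
    (hE : R.envGap₀ prob ρ ≤ D) (hd : R.dist₀ prob ρ ≤ D) (hg : R.gap₀ prob ρ ≤ D)
    (hβ : a * scale K N T ≤ p.β) (hβ' : p.β ≤ b * scale K N T)
    (hy : a * scale K N T ≤ p.μy) (hy' : p.μy ≤ b * scale K N T)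
    (hx : a * scale K N T / (Lf / ν) ≤ p.μx) (hx' : p.μx ≤ b * scale K N T / (Lf / ν))
    (hlx : p.locμx = p.μx / (N * Lf)) (hly : p.locμy = p.μy / (N * Lf))
    (hxy : p.μx ≤ p.μy / (6 * (Lf / ν))) (hβ1 : p.β ≤ 1) (hγ : p.γ = 1) :
    R.avgStat prob p ρ N T ≤ rateConst Lf Lh σ σh D (D / a) a b * rate (Lf / ν) K N T := by
  have hs := scale_pos hK hN hT
  have hLf := h.Lf_pos
  have hνp := h.ν_pos
  have hκ : 1 ≤ Lf / ν := (one_le_div hνp).2 hν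
  have hκ0 : 0 < Lf / ν := by positivity
  have hx0 : 0 < p.μx := lt_of_lt_of_le (by positivity) hx
  have hy0 : 0 < p.μy := lt_of_lt_of_le (by positivity) hy
  have hβ0 : 0 < p.β := lt_of_lt_of_le (by positivity) hβ
  have hD : 0 ≤ D := (envGap₀_nonneg h hR hK).trans hE
  refine (explicit_bound h hR hK hN hT hx0 hxy (by rw [hlx]; positivity) (by rw [hly]; positivity)
    hβ0 hβ1 hγ).2.trans ?_
  refine explicitBound_le_rate hK hN hT hLf h.Lh_nonneg h.σ_nonneg h.σh_nonneg hκ ha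
    (by positivity) hd hD hx0 hy0 ?_ ?_ hβ hβ' hy' hx' hlx hly
  · calc R.envGap₀ prob ρ / p.μx ≤ D / (a * scale K N T / (Lf / ν)) := by gcongr
      _ = _ := by rw [div_div_eq_mul_div, div_mul_eq_mul_div, div_div]
  · calc R.gap₀ prob ρ / p.μy ≤ D / (a * scale K N T) := by gcongr
      _ = _ := by rw [div_div]

/-- In each minimum defining a server step, one branch makes the ratio of initial gap to step exact
(constant `1`), and the other bounds it through `D` (constant `D σh`). Hence the maximum of the two
in the role of `A`, depending on no lower bound for the initial gaps. -/
theorem avgStat_le_rate_of_eq_min {D : ℝ} (hσ : 0 < σ) (hσh : 0 < σh) (hK : 0 < K) (hN : 0 < N)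
    (hT : N * K ≤ T ^ 2) (h : prob.Assumptions Lf Lh σ σh ν) (hν : ν ≤ Lf)
    (hR : R.Valid prob p ρ) (hE0 : 0 < R.envGap₀ prob ρ) (hE : R.envGap₀ prob ρ ≤ D)
    (hd : R.dist₀ prob ρ ≤ D) (hg0 : 0 < R.gap₀ prob ρ) (hg : R.gap₀ prob ρ ≤ D)
    (hβ : p.β = min (min (σ * scale K N T) (scale K N T / σ ^ 2)) 1)
    (hy : p.μy = min (R.gap₀ prob ρ * scale K N T) (scale K N T / σh))
    (hx : p.μx = min (scale K N T / (σh * (Lf / ν))) (R.envGap₀ prob ρ * scale K N T / (Lf / ν)))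
    (hlx : p.locμx = p.μx / (N * Lf)) (hly : p.locμy = p.μy / (N * Lf))
    (hxy : p.μx ≤ p.μy / (6 * (Lf / ν))) (hγ : p.γ = 1) :
    R.avgStat prob p ρ N T ≤ rateConst Lf Lh σ σh D (max 1 (D * σh))
      (min (min σ (1 / σ ^ 2)) 1) (max σ (1 / σh)) * rate (Lf / ν) K N T := by
  have hT0 : 0 < T := by
    rcases Nat.eq_zero_or_pos T with rfl | hT0
    · have := Nat.mul_pos hN hK
      omega
    · exact hT0
  have hs := scale_pos hK hN hT0
  have hs1 := scale_le_one hT0 hT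
  have hLf := h.Lf_pos
  have hνp := h.ν_pos
  have hκ : 1 ≤ Lf / ν := (one_le_div hνp).2 hν
  set κ := Lf / ν with hκdef
  have hκ0 : 0 < κ := by positivity
  set s := scale K N T with hsdef
  have hx0 : 0 < p.μx := by rw [hx]; exact lt_min (by positivity) (by positivity)
  have hy0 : 0 < p.μy := by rw [hy]; exact lt_min (by positivity) (by positivity)
  have hβ0 : 0 < p.β := by
    rw [hβ]; exact lt_min (lt_min (by positivity) (by positivity)) one_pos
  have hβ1 : p.β ≤ 1 := hβ ▸ min_le_right _ _
  have hD : 0 ≤ D := hE0.le.trans hE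
  have ha : 0 < min (min σ (1 / σ ^ 2)) 1 :=
    lt_min (lt_min hσ (by positivity)) one_pos
  refine (explicit_bound h hR hK hN hT0 hx0 hxy (by rw [hlx]; positivity)
    (by rw [hly]; positivity) hβ0 hβ1 hγ).2.trans ?_
  refine explicitBound_le_rate hK hN hT0 hLf h.Lh_nonneg h.σ_nonneg h.σh_nonneg hκ ha
    (by positivity) hd hD hx0 hy0 ?_ ?_ ?_ ?_ ?_ ?_ hlx hly
  · rw [← hsdef, ← hκdef, div_le_iff₀ hx0, hx]
    rcases min_choice (s / (σh * κ)) (R.envGap₀ prob ρ * s / κ) with e | e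
    · rw [e]
      calc R.envGap₀ prob ρ ≤ D := hE
        _ = D * σh * κ / s * (s / (σh * κ)) := by field_simp
        _ ≤ _ := by gcongr; exact le_max_right _ _
    · rw [e]
      calc R.envGap₀ prob ρ = 1 * κ / s * (R.envGap₀ prob ρ * s / κ) := by field_simp
        _ ≤ _ := by gcongr; exact le_max_left _ _
  · rw [← hsdef, div_le_iff₀ hy0, hy]
    rcases min_choice (R.gap₀ prob ρ * s) (s / σh) with e | e
    · rw [e]
      calc R.gap₀ prob ρ = 1 / s * (R.gap₀ prob ρ * s) := by field_simp
        _ ≤ _ := by gcongr; exact le_max_left _ _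
    · rw [e]
      calc R.gap₀ prob ρ ≤ D := hg
        _ = D * σh / s * (s / σh) := by field_simp
        _ ≤ _ := by gcongr; exact le_max_right _ _
  · rw [← hsdef, hβ]
    refine le_min (le_min ?_ ?_) ?_
    · gcongr
      exact (min_le_left _ _).trans (min_le_left _ _)
    · rw [div_eq_mul_one_div s, mul_comm s]
      gcongr
      exact (min_le_left _ _).trans (min_le_right _ _)
    -- The cap `β ≤ 1` is compatible with `a s ≤ β` because `NK ≤ T²` forces `s ≤ 1`.
    · exact mul_le_one₀ (min_le_right _ _) hs.le hs1
  · rw [← hsdef, hβ]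
    refine ((min_le_left _ _).trans (min_le_left _ _)).trans ?_
    gcongr
    exact le_max_left _ _
  · rw [← hsdef, hy]
    refine (min_le_right _ _).trans ?_
    rw [div_eq_mul_one_div s, mul_comm s]
    gcongr
    exact le_max_right _ _
  · rw [← hsdef, ← hκdef, hx]
    refine (min_le_left _ _).trans ?_
    calc s / (σh * κ) = 1 / σh * s / κ := by field_simp
      _ ≤ _ := by gcongr; exact le_max_right _ _

end Main

end FedMiMA

end

open MeasureTheory FedMiMA in
theorem mainTheorem2 :
    -- the explicit bound
    (∀ (Lf Lh σ σh ν : ℝ) (M₁ M₂ K N T : ℕ) (Ξ : Type u) [MeasurableSpace Ξ]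
        (Ω : Type v) [MeasurableSpace Ω] (ρ : Measure Ω) [IsProbabilityMeasure ρ]
        (prob : Problem M₁ M₂ K Ξ) (p : Params) (R : RunData M₁ M₂ K Ξ Ω),
      0 < K → 0 < N → 0 < T →
      prob.Assumptions Lf Lh σ σh ν → R.Valid prob p ρ →
      0 < p.μx → p.μx ≤ p.μy / (6 * (Lf / ν)) → 0 ≤ p.locμx → 0 ≤ p.locμy →
      0 < p.β → p.β ≤ 1 → p.γ = 1 →
      (∀ i < T, Integrable (R.stat prob p N i) ρ) ∧
      R.avgStat prob p ρ N T ≤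
        explicitBound Lf Lh σ σh (Lf / ν) p K N T
          (R.envGap₀ prob ρ) (R.dist₀ prob ρ) (R.gap₀ prob ρ)) ∧
    -- the rate, for all hyperparameters of the stated orders
    (∀ (Lf Lh σ σh D a b : ℝ), 0 < a → ∃ C : ℝ,
      ∀ (ν : ℝ) (M₁ M₂ K N T : ℕ) (Ξ : Type u) [MeasurableSpace Ξ]
        (Ω : Type v) [MeasurableSpace Ω] (ρ : Measure Ω) [IsProbabilityMeasure ρ]
        (prob : Problem M₁ M₂ K Ξ) (p : Params) (R : RunData M₁ M₂ K Ξ Ω),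
      0 < K → 0 < N → 0 < T →
      prob.Assumptions Lf Lh σ σh ν → ν ≤ Lf → R.Valid prob p ρ →
      R.envGap₀ prob ρ ≤ D → R.dist₀ prob ρ ≤ D → R.gap₀ prob ρ ≤ D →
      a * scale K N T ≤ p.β → p.β ≤ b * scale K N T →
      a * scale K N T ≤ p.μy → p.μy ≤ b * scale K N T →
      a * scale K N T / (Lf / ν) ≤ p.μx → p.μx ≤ b * scale K N T / (Lf / ν) →
      p.locμx = p.μx / (N * Lf) → p.locμy = p.μy / (N * Lf) →
      p.μx ≤ p.μy / (6 * (Lf / ν)) → p.β ≤ 1 → p.γ = 1 →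
      R.avgStat prob p ρ N T ≤ C * rate (Lf / ν) K N T) ∧
    -- the rate, for the explicit hyperparameters
    (∀ (Lf Lh σ σh D : ℝ), 0 < σ → 0 < σh → ∃ C : ℝ,
      ∀ (ν : ℝ) (M₁ M₂ K N T : ℕ) (Ξ : Type u) [MeasurableSpace Ξ]
        (Ω : Type v) [MeasurableSpace Ω] (ρ : Measure Ω) [IsProbabilityMeasure ρ]
        (prob : Problem M₁ M₂ K Ξ) (p : Params) (R : RunData M₁ M₂ K Ξ Ω),
      0 < K → 0 < N → N * K ≤ T ^ 2 →
      prob.Assumptions Lf Lh σ σh ν → ν ≤ Lf → R.Valid prob p ρ →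
      0 < R.envGap₀ prob ρ → R.envGap₀ prob ρ ≤ D → R.dist₀ prob ρ ≤ D →
      0 < R.gap₀ prob ρ → R.gap₀ prob ρ ≤ D →
      p.β = min (min (σ * scale K N T) (scale K N T / σ ^ 2)) 1 →
      p.μy = min (R.gap₀ prob ρ * scale K N T) (scale K N T / σh) →
      p.μx = min (scale K N T / (σh * (Lf / ν))) (R.envGap₀ prob ρ * scale K N T / (Lf / ν)) →
      p.locμx = p.μx / (N * Lf) → p.locμy = p.μy / (N * Lf) →
      p.μx ≤ p.μy / (6 * (Lf / ν)) → p.γ = 1 →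
      R.avgStat prob p ρ N T ≤ C * rate (Lf / ν) K N T) := by
  refine ⟨?_, ?_, ?_⟩
  · intro Lf Lh σ σh ν M₁ M₂ K N T Ξ _ Ω _ ρ _ prob p R hK hN hT h hR hx hxy hlx hly hβ hβ1 hγ
    exact explicit_bound h hR hK hN hT hx hxy hlx hly hβ hβ1 hγ
  · intro Lf Lh σ σh D a b ha
    refine ⟨rateConst Lf Lh σ σh D (D / a) a b, ?_⟩
    intro ν M₁ M₂ K N T Ξ _ Ω _ ρ _ prob p R hK hN hT h hν hR hE hd hg hβ hβ' hy hy' hx hx' hlx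
      hly hxy hβ1 hγ
    exact avgStat_le_rate_of_le_scale ha hK hN hT h hν hR hE hd hg hβ hβ' hy hy' hx hx' hlx hly
      hxy hβ1 hγ
  · intro Lf Lh σ σh D hσ hσh
    refine ⟨rateConst Lf Lh σ σh D (max 1 (D * σh)) (min (min σ (1 / σ ^ 2)) 1)
      (max σ (1 / σh)), ?_⟩
    intro ν M₁ M₂ K N T Ξ _ Ω _ ρ _ prob p R hK hN hT h hν hR hE0 hE hd hg0 hg hβ hy hx hlx hly
      hxy hγ
    exact avgStat_le_rate_of_eq_min hσ hσh hK hN hT h hν hR hE0 hE hd hg0 hg hβ hy hx hlx hly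
      hxy hγ
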